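/- Let $K$ be a simplicial complex on the vertex set $[m]=\{1,\dots,m\}$, $m\ge 0$ (the empty simplex belongs to $K$; an element of $[m]$ is not required to be a vertex of $K$). A simplex $\omega\in K$ has dimension $|\omega|-1$; $\dim K$ is the largest dimension of a simplex of $K$, and $\operatorname{mdim}K$ is the smallest dimension of a simplex of $K$ that is maximal by inclusion. Let $$\mathcal Z_K=\bigcup_{\omega\in K}\{(z_1,\dots,z_m)\in (D^2)^m \mid z_i\in S^1\text{ for } i\notin\omega\}\subset\mathbb C^m$$ be the moment-angle complex, where $D^2\subset\mathbb C$ is the closed unit disc and $S^1$ its boundary circle, and let $T^m=(S^1)^m$ act on $\mathcal Z_K$ coordinatewise. Write $\operatorname{hrk}(X;\mathbb Q)=\sum_{i\ge 0}\dim_{\mathbb Q} H^i(X;\mathbb Q)$ (singular cohomology). Then $$\operatorname{hrk}(\mathcal Z_K;\mathbb Q)\ \ge\ 2^{\,m-\operatorname{mdim}K-1}\ \ge\ 2^{\,m-\dim K-1}.$$ Moreover, Halperin's toral rank conjecture holds for the actions of subtori of $T^m$ on $\mathcal Z_K$: if a subtorus $H\subset T^m$ of rank $r$ (a subgroup isomorphic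 to $T^r$ as a topological group) acts almost freely on $\mathcal Z_K$, that is, with all isotropy groups finite, then $$\operatorname{hrk}(\mathcal Z_K;\mathbb Q)\ \ge\ 2^{r}.$$ -/

import Mathlib

open CategoryTheory AlgebraicTopology
open scoped ENNReal

noncomputable section

namespace MomentAngle

/-- The `i`-th singular cohomology group of `X` with rational coefficients: the cohomology of the
cochain complex `Hom(C_•(X; ℚ), ℚ)`, where `C_•(X; ℚ)` is the singular chain complex. -/
def singularCohomology (X : Type) [TopologicalSpace X] (i : ℕ) : ModuleCat.{0} ℚ :=
  ((((singularChainComplexFunctor (ModuleCat.{0} ℚ)).obj (ModuleCat.of ℚ ℚ)).obj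
    (TopCat.of X)).linearYonedaObj ℚ (ModuleCat.of ℚ ℚ)).homology i

/-- The total rational cohomology rank `∑ i, dim H^i(X; ℚ)`, a value in `ℕ ∪ {∞}`. -/
def hrk (X : Type) [TopologicalSpace X] : ℕ∞ :=
  ∑' i : ℕ, Cardinal.toENat (Module.rank ℚ (singularCohomology X i))

section Complexes

variable {m : ℕ}

/-- The simplices of a simplicial complex on `[m]`: its nonempty faces and the empty simplex
(Mathlib's complexes record the nonempty faces only). -/
def IsSimplex (K : PreAbstractSimplicialComplex (Fin m)) (ω : Finset (Fin m)) : Prop :=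
  ω = ∅ ∨ ω ∈ K

open Classical in
/-- The dimension of `K`: the largest dimension `|ω| - 1` of a simplex `ω` of `K`
(so `-1` when the empty simplex is the only one). -/
def dim (K : PreAbstractSimplicialComplex (Fin m)) : ℤ :=
  (((Finset.univ.filter (IsSimplex K)).sup Finset.card : ℕ) : ℤ) - 1

/-- The smallest dimension `|ω| - 1` of a simplex `ω` of `K` that is maximal by inclusion. -/
def mdim (K : PreAbstractSimplicialComplex (Fin m)) : ℤ :=
  ((sInf (Finset.card '' {ω | Maximal (IsSimplex K) ω}) : ℕ) : ℤ) - 1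

/-- The infimum in `mdim` is attained. -/
theorem exists_maximal_card_eq_mdim (K : PreAbstractSimplicialComplex (Fin m)) :
    ∃ ω, Maximal (IsSimplex K) ω ∧ (ω.card : ℤ) - 1 = mdim K := by
  have h0 : {ω | IsSimplex K ω}.Nonempty := ⟨∅, Or.inl rfl⟩
  obtain ⟨ω, hω⟩ := (Set.toFinite {ω | IsSimplex K ω}).exists_maximal h0
  have hne : (Finset.card '' {ω | Maximal (IsSimplex K) ω}).Nonempty := ⟨_, ω, hω, rfl⟩
  obtain ⟨τ, hτ, h⟩ := Nat.sInf_mem hne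
  exact ⟨τ, hτ, by rw [mdim, h]⟩

/-- The `K`-power `(X, A)^K` of a pair of subspaces `A ⊆ X` of `E`: the union over the simplices
`ω` of `K` of the sets `{x ∈ X^m | x i ∈ A for i ∉ ω}`. -/
def kPower {E : Type} (X A : Set E) (K : PreAbstractSimplicialComplex (Fin m)) :
    Set (Fin m → E) :=
  ⋃ ω ∈ {ω | IsSimplex K ω}, {x | (∀ i, x i ∈ X) ∧ ∀ i, i ∉ ω → x i ∈ A}

/-- The moment-angle complex `Z_K = (D², S¹)^K`, a subspace of `ℂ^m`. -/
def momentAngleComplex (K : PreAbstractSimplicialComplex (Fin m)) : Set (Fin m → ℂ) :=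
  kPower (Metric.closedBall (0 : ℂ) 1) (Metric.sphere (0 : ℂ) 1) K

theorem smul_mem_momentAngleComplex (K : PreAbstractSimplicialComplex (Fin m))
    (t : Fin m → Circle) {x : Fin m → ℂ} (hx : x ∈ momentAngleComplex K) :
    t • x ∈ momentAngleComplex K := by
  simp only [momentAngleComplex, kPower, Set.mem_iUnion, Set.mem_ofPred_eq, Pi.smul_apply',
    mem_closedBall_zero_iff, mem_sphere_zero_iff_norm, Circle.norm_smul] at hx ⊢
  exact hx

/-- The coordinatewise action of the torus `T^m` on `Z_K`. -/
instance (K : PreAbstractSimplicialComplex (Fin m)) :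
    MulAction (Fin m → Circle) (momentAngleComplex K) where
  smul t x := ⟨t • x.1, smul_mem_momentAngleComplex K t x.2⟩
  one_smul x := Subtype.ext (one_smul _ x.1)
  mul_smul s t x := Subtype.ext (mul_smul s t x.1)

/-- `H` is a subtorus of rank `r` of `T^m`: a subgroup that is isomorphic to `T^r` as a
topological group. -/
def IsSubtorus (H : Subgroup (Fin m → Circle)) (r : ℕ) : Prop :=
  Nonempty (H ≃ₜ* (Fin r → Circle))

end Complexes

/-- An action is almost free if all its isotropy groups are finite. -/
def IsAlmostFree (G X : Type) [Group G] [MulAction G X] : Prop :=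
  ∀ x : X, Finite (MulAction.stabilizer G x)

end MomentAngle

end

/-! The bound comes from cutting `Z_K` down, one coordinate at a time, to a region whose number of
path components is visible, without ever increasing the total rational homology. Let `T` be the
space at some stage, and let `A`, `B` be relatively open subsets covering `T`, given by conditions
`z i ∈ O` and `z i ∈ O'`. Suppose that `A` and `B` deform within themselves to `z i = c` and `z i =
c'`, with `c`, `c'` on the unit circle. Setting `z i` to a point of the circle never leaves `Z_K`,
so the retractions are defined on all of `T`, and `A` and `B` inject into `T` in homology.
Mayer–Vietoris then gives rank `H(A ∩ B)` ≤ rank `H(T)`: the image of `H(A ∩ B)` in `H(T)` lies in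
the span `L` of the images of `H(A)` and `H(B)`, while the kernel is the image of the connecting
map, which factors through `H(T) / L` (`rank_subHomology_inf_le`, `subRank_boxed_update_le`).

Fix a maximal simplex `ω`. Every coordinate is first cut to the complement of `±1`; coordinates in
`ω` are then cut to the open disc by two caps around `±i`. The deformations are hyperbolic
translations, which preserve the disc and the circle. In the remaining region all coordinates in `ω`
are interior, so by maximality the others lie on the circle minus `±1`, and the signs of their
imaginary parts separate `2 ^ (m - |ω|)` classes in `H_0` (`two_pow_le_subRank`).

Singular chains are handled as one ungraded vector space with a differential; subdivision and prisms
are constructed on tuples of points and transported along singular simplices. The passage to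
cohomology is the pairing over a field (`natCast_le_hrk`). For the toral rank statement, a count of
`p`-torsion for a large prime `p` gives `r ≤ m - |ω|` (`rank_le_of_isAlmostFree`). -/

noncomputable section

namespace MomentAngle

/-! ### Convex spaces and ordered affine chains -/

/-- The convex combination of points of a standard simplex. -/
def simplexComb {k n : ℕ} (t : stdSimplex ℝ (Fin k)) (u : Fin k → stdSimplex ℝ (Fin n)) :
    stdSimplex ℝ (Fin n) :=
  ⟨∑ i, t i • (u i).1, (convex_stdSimplex ℝ (Fin n)).sum_mem (fun i _ ↦ t.2.1 i) t.2.2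
    (fun i _ ↦ (u i).2)⟩

theorem simplexComb_apply {k n : ℕ} (t : stdSimplex ℝ (Fin k)) (u : Fin k → stdSimplex ℝ (Fin n))
    (j : Fin n) : simplexComb t u j = ∑ i, t i * u i j := by
  change (∑ i, t i • (u i).1) j = _
  simp [Finset.sum_apply]
  rfl

/-- A topological space with convex combinations of finitely many points. -/
class TopConvex (D : Type) [TopologicalSpace D] where
  /-- The convex combination of the points `v i` with weights `t i`. -/
  comb : ∀ {k : ℕ}, stdSimplex ℝ (Fin k) → (Fin k → D) → D
  comb_vertex : ∀ {k : ℕ} (i : Fin k) (v : Fin k → D), comb (stdSimplex.vertex i) v = v i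
  comb_comb : ∀ {k l : ℕ} (t : stdSimplex ℝ (Fin k)) (u : Fin k → stdSimplex ℝ (Fin l))
    (v : Fin l → D), comb t (fun i ↦ comb (u i) v) = comb (simplexComb t u) v
  continuous_comb : ∀ {k : ℕ} (v : Fin k → D), Continuous fun t ↦ comb t v

instance (n : ℕ) : TopConvex (stdSimplex ℝ (Fin n)) where
  comb := simplexComb
  comb_vertex i v := by
    ext j
    simp [simplexComb_apply, Pi.single_apply]
  comb_comb t u v := by
    ext j
    simp only [simplexComb_apply, Finset.mul_sum, Finset.sum_mul]
    rw [Finset.sum_comm]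
    simp only [mul_assoc]
  continuous_comb v := by
    refine Continuous.subtype_mk ?_ _
    exact continuous_finsetSum _ fun i _ ↦
      ((continuous_apply i).comp continuous_subtype_val).smul continuous_const

instance (D D' : Type) [TopologicalSpace D] [TopologicalSpace D'] [TopConvex D] [TopConvex D'] :
    TopConvex (D × D') where
  comb t v := (TopConvex.comb t fun i ↦ (v i).1, TopConvex.comb t fun i ↦ (v i).2)
  comb_vertex i v := by simp [TopConvex.comb_vertex]
  comb_comb t u v := by simp [TopConvex.comb_comb]
  continuous_comb v := (TopConvex.continuous_comb _).prodMk (TopConvex.continuous_comb _)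

section Tuples

variable {D D' : Type}

/-- The augmented chain complex of ordered tuples of points of `D`. -/
abbrev TChain (D : Type) : Type := (Σ n : ℕ, Fin n → D) →₀ ℚ

/-- A tuple as a chain. -/
abbrev tup {n : ℕ} (v : Fin n → D) : TChain D := Finsupp.single ⟨n, v⟩ 1

/-- Extension of a function on tuples to a linear map on chains. -/
abbrev tupLift {M : Type} [AddCommGroup M] [Module ℚ M] (f : ∀ n, (Fin n → D) → M) :
    TChain D →ₗ[ℚ] M :=
  Finsupp.linearCombination ℚ fun p : Σ n : ℕ, Fin n → D ↦ f p.1 p.2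

theorem tupLift_tup {M : Type} [AddCommGroup M] [Module ℚ M] (f : ∀ n, (Fin n → D) → M)
    {n : ℕ} (v : Fin n → D) : tupLift f (tup v) = f n v := by
  simp [tupLift, tup, Finsupp.linearCombination_single]

theorem tup_hom_ext {M : Type} [AddCommGroup M] [Module ℚ M] {f g : TChain D →ₗ[ℚ] M}
    (h : ∀ (n : ℕ) (v : Fin n → D), f (tup v) = g (tup v)) : f = g := by
  refine Finsupp.lhom_ext fun p c ↦ ?_
  have := h p.1 p.2
  rw [show Finsupp.single p c = c • tup p.2 by simp [tup]]
  rw [map_smul, map_smul, this]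

/-- The value of the boundary operator on a tuple. -/
def tbdAux : ∀ n : ℕ, (Fin n → D) → TChain D
  | 0, _ => 0
  | n + 1, v => ∑ i : Fin (n + 1), (-1 : ℚ) ^ (i : ℕ) • tup (v ∘ i.succAbove)

variable (D) in
/-- The boundary operator on chains of tuples. -/
def tbd : TChain D →ₗ[ℚ] TChain D := tupLift tbdAux

theorem tbd_zero (v : Fin 0 → D) : tbd D (tup v) = 0 := by
  rw [tbd, tupLift_tup, tbdAux]

theorem tbd_succ {n : ℕ} (v : Fin (n + 1) → D) :
    tbd D (tup v) = ∑ i : Fin (n + 1), (-1 : ℚ) ^ (i : ℕ) • tup (v ∘ i.succAbove) := by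
  rw [tbd, tupLift_tup, tbdAux]

/-- The cone with vertex `b`. -/
def cone (b : D) : TChain D →ₗ[ℚ] TChain D := tupLift fun _ v ↦ tup (Fin.cons b v : Fin _ → D)

theorem cone_tup (b : D) {n : ℕ} (v : Fin n → D) :
    cone b (tup v) = tup (Fin.cons b v : Fin (n + 1) → D) := by
  rw [cone, tupLift_tup]

/-- Every inductive identity below rests on this formula. The empty tuple is included as a generator
so that it holds without exception: the boundary of a single vertex is the empty tuple. -/
theorem tbd_cone (b : D) (x : TChain D) : tbd D (cone b x) = x - cone b (tbd D x) := by
  suffices h : tbd D ∘ₗ cone b = LinearMap.id - cone b ∘ₗ tbd D from LinearMap.congr_fun h x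
  refine tup_hom_ext fun n v ↦ ?_
  simp only [LinearMap.comp_apply, LinearMap.sub_apply, LinearMap.id_apply, cone_tup]
  rw [tbd_succ, Fin.sum_univ_succ]
  have h0 : (Fin.cons b v : Fin (n + 1) → D) ∘ (0 : Fin (n + 1)).succAbove = v := by
    ext j; simp
  rw [h0]
  cases n with
  | zero => simp [tbd_zero]
  | succ n =>
    rw [tbd_succ, map_sum, sub_eq_add_neg, ← Finset.sum_neg_distrib]
    simp only [map_smul, cone_tup, Fin.val_zero, pow_zero, one_smul, Fin.val_succ, pow_succ]
    congr 1
    refine Finset.sum_congr rfl fun i _ ↦ ?_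
    rw [Fin.cons_comp_succ_succAbove, mul_neg_one, neg_smul]
    rfl

theorem tup_eq_cone {n : ℕ} (v : Fin (n + 1) → D) : tup v = cone (v 0) (tup (Fin.tail v)) := by
  rw [cone_tup, Fin.cons_self_tail]

theorem tbd_tbd (x : TChain D) : tbd D (tbd D x) = 0 := by
  suffices h : tbd D ∘ₗ tbd D = 0 from LinearMap.congr_fun h x
  refine tup_hom_ext fun n ↦ ?_
  induction n with
  | zero => intro v; simp [tbd_zero]
  | succ n ih =>
    intro v
    have := ih (Fin.tail v)
    simp only [LinearMap.comp_apply, LinearMap.zero_apply] at this ⊢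
    rw [tup_eq_cone, tbd_cone, map_sub, tbd_cone, this]
    simp

/-- The map on chains of tuples induced by a map. -/
def tmap (α : D → D') : TChain D →ₗ[ℚ] TChain D' := tupLift fun _ v ↦ tup (α ∘ v)

theorem tmap_tup (α : D → D') {n : ℕ} (v : Fin n → D) : tmap α (tup v) = tup (α ∘ v) := by
  rw [tmap, tupLift_tup]

theorem tmap_tbd (α : D → D') (x : TChain D) : tmap α (tbd D x) = tbd D' (tmap α x) := by
  suffices h : tmap α ∘ₗ tbd D = tbd D' ∘ₗ tmap α from LinearMap.congr_fun h x
  refine tup_hom_ext fun n v ↦ ?_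
  simp only [LinearMap.comp_apply, tmap_tup]
  cases n with
  | zero => simp [tbd_zero]
  | succ n => simp only [tbd_succ, map_sum, map_smul, tmap_tup, Function.comp_assoc]

theorem tmap_cone (α : D → D') (b : D) (x : TChain D) :
    tmap α (cone b x) = cone (α b) (tmap α x) := by
  suffices h : tmap α ∘ₗ cone b = cone (α b) ∘ₗ tmap α from LinearMap.congr_fun h x
  refine tup_hom_ext fun n v ↦ ?_
  simp only [LinearMap.comp_apply, tmap_tup, cone_tup]
  rw [Fin.comp_cons]

/-- Two linear maps that agree on tuples of length `n` agree on boundaries of longer tuples. -/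
theorem eq_on_tbd {M : Type} [AddCommGroup M] [Module ℚ M] {f g : TChain D →ₗ[ℚ] M} {n : ℕ}
    (h : ∀ v : Fin n → D, f (tup v) = g (tup v)) (v : Fin (n + 1) → D) :
    f (tbd D (tup v)) = g (tbd D (tup v)) := by
  simp only [tbd_succ, map_sum, map_smul, h]

section Subdivision

variable [TopologicalSpace D] [TopologicalSpace D'] [TopConvex D] [TopConvex D']

/-- The affine singular simplex with the given vertices. -/
def aff {k : ℕ} (v : Fin k → D) : C(stdSimplex ℝ (Fin k), D) :=
  ⟨fun t ↦ TopConvex.comb t v, TopConvex.continuous_comb v⟩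

/-- Maps that preserve convex combinations. -/
def IsAff (α : D → D') : Prop :=
  ∀ (k : ℕ) (t : stdSimplex ℝ (Fin k)) (v : Fin k → D),
    α (TopConvex.comb t v) = TopConvex.comb t (α ∘ v)

theorem isAff_aff {k : ℕ} (v : Fin k → D) : IsAff (aff v) := fun _ t u ↦
  (TopConvex.comb_comb t u v).symm

theorem aff_vertex {k : ℕ} (v : Fin k → D) (i : Fin k) : aff v (stdSimplex.vertex i) = v i :=
  TopConvex.comb_vertex i v

theorem aff_comp_vertex {k : ℕ} (v : Fin k → D) : aff v ∘ stdSimplex.vertex = v :=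
  funext (aff_vertex v)

theorem aff_vertices {n : ℕ} :
    aff (stdSimplex.vertex : Fin n → stdSimplex ℝ (Fin n)) = ContinuousMap.id _ := by
  ext t j
  change simplexComb t _ j = t j
  simp [simplexComb_apply, Pi.single_apply]

theorem IsAff.comp_aff {α : C(D, D')} (hα : IsAff α) {k : ℕ} (v : Fin k → D) :
    α.comp (aff v) = aff (α ∘ v) := by
  ext t
  exact hα _ t v

/-- The `i`-th face inclusion of standard simplices. -/
def face {n : ℕ} (i : Fin (n + 1)) : C(stdSimplex ℝ (Fin n), stdSimplex ℝ (Fin (n + 1))) :=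
  aff fun j ↦ stdSimplex.vertex (i.succAbove j)

theorem face_eq_map {n : ℕ} (i : Fin (n + 1)) (t : stdSimplex ℝ (Fin n)) :
    face i t = stdSimplex.map i.succAbove t := by
  ext j
  change simplexComb t _ j = _
  rw [simplexComb_apply, stdSimplex.map_coe, FunOnFinite.linearMap_apply_apply, Finset.sum_filter]
  simp [Pi.single_apply, eq_comm]

theorem aff_comp_face {n : ℕ} (v : Fin (n + 1) → D) (i : Fin (n + 1)) :
    (aff v).comp (face i) = aff (v ∘ i.succAbove) := by
  rw [face, (isAff_aff v).comp_aff]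
  congr 1
  ext j
  exact aff_vertex v _

/-! ### Barycentric subdivision of tuples -/

/-- The barycenter of a nonempty tuple. -/
def bary {n : ℕ} (v : Fin (n + 1) → D) : D := aff v stdSimplex.barycenter

/-- The value of the subdivision operator on a tuple. -/
def sdAux : ∀ n : ℕ, (Fin n → D) → TChain D
  | 0, v => tup v
  | n + 1, v => cone (bary v) (∑ i : Fin (n + 1), (-1 : ℚ) ^ (i : ℕ) • sdAux n (v ∘ i.succAbove))

variable (D) in
/-- Barycentric subdivision of chains of tuples. -/
def sd : TChain D →ₗ[ℚ] TChain D := tupLift sdAux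

theorem sd_zero (v : Fin 0 → D) : sd D (tup v) = tup v := by
  rw [sd, tupLift_tup, sdAux]

theorem sd_succ {n : ℕ} (v : Fin (n + 1) → D) :
    sd D (tup v) = cone (bary v) (sd D (tbd D (tup v))) := by
  rw [tbd_succ, map_sum, sd, tupLift_tup, sdAux]
  simp only [map_smul, tupLift_tup]

/-- The value on a tuple of the homotopy between the identity and the subdivision. -/
def sdHtpyAux : ∀ n : ℕ, (Fin n → D) → TChain D
  | 0, _ => 0
  | n + 1, v => cone (bary v)
      (tup v - ∑ i : Fin (n + 1), (-1 : ℚ) ^ (i : ℕ) • sdHtpyAux n (v ∘ i.succAbove))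

variable (D) in
/-- The chain homotopy between the identity and the subdivision. -/
def sdHtpy : TChain D →ₗ[ℚ] TChain D := tupLift sdHtpyAux

theorem sdHtpy_zero (v : Fin 0 → D) : sdHtpy D (tup v) = 0 := by
  rw [sdHtpy, tupLift_tup, sdHtpyAux]

theorem sdHtpy_succ {n : ℕ} (v : Fin (n + 1) → D) :
    sdHtpy D (tup v) = cone (bary v) (tup v - sdHtpy D (tbd D (tup v))) := by
  rw [tbd_succ, map_sum, sdHtpy, tupLift_tup, sdHtpyAux]
  simp only [map_smul, tupLift_tup]

theorem tbd_sd (x : TChain D) : tbd D (sd D x) = sd D (tbd D x) := by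
  suffices h : tbd D ∘ₗ sd D = sd D ∘ₗ tbd D from LinearMap.congr_fun h x
  refine tup_hom_ext fun n ↦ ?_
  induction n with
  | zero => intro v; simp [tbd_zero, sd_zero]
  | succ n ih =>
    intro v
    have := eq_on_tbd ih v
    simp only [LinearMap.comp_apply] at this ⊢
    rw [sd_succ, tbd_cone, this, tbd_tbd]
    simp

/-- The homotopy of `v` is the cone from the barycenter over `v - sdHtpy (∂v)`. By induction the
boundary of this base is `sd (∂v)`, whose cone is `sd v`, so `tbd_cone` gives the formula. -/
theorem tbd_sdHtpy (x : TChain D) :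
    tbd D (sdHtpy D x) = x - sd D x - sdHtpy D (tbd D x) := by
  suffices h : tbd D ∘ₗ sdHtpy D = LinearMap.id - sd D - sdHtpy D ∘ₗ tbd D from
    LinearMap.congr_fun h x
  refine tup_hom_ext fun n ↦ ?_
  induction n with
  | zero => intro v; simp [tbd_zero, sd_zero, sdHtpy_zero]
  | succ n ih =>
    intro v
    have := eq_on_tbd ih v
    simp only [LinearMap.comp_apply, LinearMap.sub_apply, LinearMap.id_apply] at this ⊢
    rw [sdHtpy_succ, tbd_cone, map_sub, this, tbd_tbd, sd_succ]
    simp only [map_zero, sub_zero, map_sub]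
    abel

theorem IsAff.bary {α : D → D'} (hα : IsAff α) {n : ℕ} (v : Fin (n + 1) → D) :
    α (bary v) = MomentAngle.bary (α ∘ v) := hα _ _ _

theorem IsAff.tmap_sd {α : D → D'} (hα : IsAff α) (x : TChain D) :
    tmap α (sd D x) = sd D' (tmap α x) := by
  suffices h : tmap α ∘ₗ sd D = sd D' ∘ₗ tmap α from LinearMap.congr_fun h x
  refine tup_hom_ext fun n ↦ ?_
  induction n with
  | zero => intro v; simp [sd_zero, tmap_tup]
  | succ n ih =>
    intro v
    have := eq_on_tbd ih v
    simp only [LinearMap.comp_apply] at this ⊢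
    rw [sd_succ, tmap_cone, this, tmap_tup, sd_succ, hα.bary, tmap_tbd, tmap_tup]

theorem IsAff.tmap_sdHtpy {α : D → D'} (hα : IsAff α) (x : TChain D) :
    tmap α (sdHtpy D x) = sdHtpy D' (tmap α x) := by
  suffices h : tmap α ∘ₗ sdHtpy D = sdHtpy D' ∘ₗ tmap α from LinearMap.congr_fun h x
  refine tup_hom_ext fun n ↦ ?_
  induction n with
  | zero => intro v; simp [sdHtpy_zero, tmap_tup]
  | succ n ih =>
    intro v
    have := eq_on_tbd ih v
    simp only [LinearMap.comp_apply] at this ⊢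
    rw [sdHtpy_succ, tmap_cone, map_sub, this, tmap_tup, sdHtpy_succ, hα.bary, tmap_tbd, tmap_tup]

end Subdivision

/-! ### The prism operator on tuples -/

/-- The unit interval as a standard simplex. -/
abbrev Interval : Type := stdSimplex ℝ (Fin 2)

/-- The value of the prism operator on a tuple. -/
def prismAux : ∀ n : ℕ, (Fin n → D) → TChain (D × Interval)
  | 0, _ => 0
  | n + 1, v => cone (v 0, stdSimplex.vertex 0)
      (tup (fun i ↦ (v i, stdSimplex.vertex 1)) - prismAux n (Fin.tail v))

variable (D) in
/-- The prism operator on chains of tuples. -/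
def prism : TChain D →ₗ[ℚ] TChain (D × Interval) := tupLift prismAux

variable (D) in
/-- The map on chains of tuples induced by the inclusion of `D` at an end of the cylinder. -/
def tend (e : Fin 2) : TChain D →ₗ[ℚ] TChain (D × Interval) :=
  tmap fun d ↦ (d, stdSimplex.vertex e)

theorem prism_zero (v : Fin 0 → D) : prism D (tup v) = 0 := by
  rw [prism, tupLift_tup, prismAux]

theorem prism_cone (b : D) (x : TChain D) :
    prism D (cone b x) = cone (b, stdSimplex.vertex 0) (tend D 1 (cone b x) - prism D x) := by
  suffices h : prism D ∘ₗ cone b =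
      cone (b, stdSimplex.vertex 0) ∘ₗ (tend D 1 ∘ₗ cone b - prism D) from LinearMap.congr_fun h x
  refine tup_hom_ext fun n v ↦ ?_
  simp only [LinearMap.comp_apply, LinearMap.sub_apply, cone_tup, tend, tmap_tup, prism,
    tupLift_tup, prismAux]
  simp [Function.comp_def]

/-- Unrolled, the recursion is the classical alternating sum of the tuples `(v₀, …, vᵢ, wᵢ, …, wₙ)`,
with the `v` at the bottom end and the `w` at the top. In recursive form the identity follows by
writing a tuple as a cone over its tail and applying `tbd_cone`. -/
theorem tbd_prism (x : TChain D) :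
    tbd _ (prism D x) = tend D 1 x - tend D 0 x - prism D (tbd D x) := by
  suffices h : tbd _ ∘ₗ prism D = tend D 1 - tend D 0 - prism D ∘ₗ tbd D from
    LinearMap.congr_fun h x
  refine tup_hom_ext fun n ↦ ?_
  induction n with
  | zero =>
    intro v
    simp only [LinearMap.comp_apply, LinearMap.sub_apply, prism_zero, tbd_zero, map_zero, tend,
      tmap_tup, sub_zero]
    rw [Subsingleton.elim ((fun d : D ↦ (d, stdSimplex.vertex (S := ℝ) (1 : Fin 2))) ∘ v)
      ((fun d ↦ (d, stdSimplex.vertex 0)) ∘ v), sub_self]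
  | succ n ih =>
    intro v
    have := ih (Fin.tail v)
    simp only [LinearMap.comp_apply, LinearMap.sub_apply] at this ⊢
    rw [tup_eq_cone]
    generalize tup (Fin.tail v) = w at *
    generalize v 0 = a
    have h0 : tend D 0 (cone a w) = cone (a, stdSimplex.vertex 0) (tend D 0 w) := tmap_cone _ _ _
    have h1 : tbd _ (tend D 1 (cone a w)) = tend D 1 w - tend D 1 (cone a (tbd D w)) := by
      rw [tend, ← tmap_tbd, tbd_cone, map_sub]
    rw [prism_cone, tbd_cone, map_sub, this, h1, h0, tbd_cone, map_sub (prism D), prism_cone]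
    simp only [map_sub]
    abel

theorem tmap_prism (α : D → D') (x : TChain D) :
    tmap (Prod.map α id) (prism D x) = prism D' (tmap α x) := by
  suffices h : tmap (Prod.map α id) ∘ₗ prism D = prism D' ∘ₗ tmap α from LinearMap.congr_fun h x
  refine tup_hom_ext fun n ↦ ?_
  induction n with
  | zero => intro v; simp [prism_zero, tmap_tup]
  | succ n ih =>
    intro v
    have := ih (Fin.tail v)
    simp only [LinearMap.comp_apply] at this ⊢
    have h : tmap (Prod.map α id) (tend D 1 (tup v)) = tend D' 1 (tmap α (tup v)) := by
      simp only [tend, tmap_tup]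
      rfl
    rw [tup_eq_cone] at h ⊢
    rw [prism_cone, tmap_cone, map_sub, this, tmap_cone, prism_cone, h, tmap_cone]
    rfl

end Tuples

/-! ### Singular chains -/

section SingularChains

variable {D D' E E' : Type} [TopologicalSpace E] [TopologicalSpace E']

/-- Singular simplices of all dimensions. -/
abbrev SSimplex (E : Type) [TopologicalSpace E] : Type :=
  Σ n : ℕ, C(stdSimplex ℝ (Fin (n + 1)), E)

/-- The direct sum of the groups of rational singular chains. -/
abbrev SChain (E : Type) [TopologicalSpace E] : Type := SSimplex E →₀ ℚ

/-- A singular simplex as a chain. -/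
abbrev ssx {n : ℕ} (σ : C(stdSimplex ℝ (Fin (n + 1)), E)) : SChain E := Finsupp.single ⟨n, σ⟩ 1

/-- Extension of a function on singular simplices to a linear map on chains. -/
abbrev chainLift {M : Type} [AddCommGroup M] [Module ℚ M]
    (f : ∀ n, C(stdSimplex ℝ (Fin (n + 1)), E) → M) : SChain E →ₗ[ℚ] M :=
  Finsupp.linearCombination ℚ fun p : SSimplex E ↦ f p.1 p.2

theorem chainLift_ssx {M : Type} [AddCommGroup M] [Module ℚ M]
    (f : ∀ n, C(stdSimplex ℝ (Fin (n + 1)), E) → M) {n : ℕ}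
    (σ : C(stdSimplex ℝ (Fin (n + 1)), E)) : chainLift f (ssx σ) = f n σ := by
  simp [chainLift, ssx, Finsupp.linearCombination_single]

/-- The chains supported on simplices with image in `P`. -/
def sub (P : Set E) : Submodule ℚ (SChain E) :=
  Finsupp.supported ℚ ℚ {p : SSimplex E | ∀ t, p.2 t ∈ P}

theorem sub_eq_span (P : Set E) : sub P = Submodule.span ℚ
    ((fun p : SSimplex E ↦ ssx p.2) '' {p : SSimplex E | ∀ t, p.2 t ∈ P}) :=
  Finsupp.supported_eq_span_single ℚ _

theorem ssx_mem_sub {P : Set E} {n : ℕ} {σ : C(stdSimplex ℝ (Fin (n + 1)), E)}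
    (h : ∀ t, σ t ∈ P) : ssx σ ∈ sub P :=
  Finsupp.single_mem_supported ℚ 1 h

theorem sub_mono {P Q : Set E} (h : P ⊆ Q) : sub P ≤ sub Q :=
  Finsupp.supported_mono fun _ hp t ↦ h (hp t)

theorem sub_inter (P Q : Set E) : sub (P ∩ Q) = sub P ⊓ sub Q := by
  rw [sub, sub, sub, ← Finsupp.supported_inter]
  congr 1
  ext p
  exact forall_and

theorem sub_univ : sub (Set.univ : Set E) = ⊤ := by
  rw [eq_top_iff, sub]
  simp

theorem map_mem_of_mem_sub {M : Type} [AddCommGroup M] [Module ℚ M] {f : SChain E →ₗ[ℚ] M}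
    {P : Set E} {q : Submodule ℚ M}
    (h : ∀ (n : ℕ) (σ : C(stdSimplex ℝ (Fin (n + 1)), E)), (∀ t, σ t ∈ P) → f (ssx σ) ∈ q)
    {x : SChain E} (hx : x ∈ sub P) : f x ∈ q := by
  rw [sub_eq_span] at hx
  refine (Submodule.span_le (p := q.comap f)).2 ?_ hx
  rintro _ ⟨p, hp, rfl⟩
  exact h p.1 p.2 hp

theorem eqOn_sub {M : Type} [AddCommGroup M] [Module ℚ M] {f g : SChain E →ₗ[ℚ] M} {P : Set E}
    (h : ∀ (n : ℕ) (σ : C(stdSimplex ℝ (Fin (n + 1)), E)), (∀ t, σ t ∈ P) →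
      f (ssx σ) = g (ssx σ)) {x : SChain E} (hx : x ∈ sub P) : f x = g x := by
  have : (f - g) x ∈ (⊥ : Submodule ℚ M) :=
    map_mem_of_mem_sub (fun n σ hσ ↦ by simpa [sub_eq_zero] using h n σ hσ) hx
  simpa [sub_eq_zero] using this

theorem ssx_hom_ext {M : Type} [AddCommGroup M] [Module ℚ M] {f g : SChain E →ₗ[ℚ] M}
    (h : ∀ (n : ℕ) (σ : C(stdSimplex ℝ (Fin (n + 1)), E)), f (ssx σ) = g (ssx σ)) : f = g :=
  LinearMap.ext fun x ↦ eqOn_sub (P := Set.univ) (fun n σ _ ↦ h n σ) (by simp [sub_univ])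

/-- The value of the boundary operator on a singular simplex. -/
def bdAux : ∀ n : ℕ, C(stdSimplex ℝ (Fin (n + 1)), E) → SChain E
  | 0, _ => 0
  | n + 1, σ => ∑ i : Fin (n + 2), (-1 : ℚ) ^ (i : ℕ) • ssx (σ.comp (face i))

variable (E) in
/-- The boundary operator on singular chains. -/
def bd : SChain E →ₗ[ℚ] SChain E := chainLift bdAux

theorem bd_zero (σ : C(stdSimplex ℝ (Fin (0 + 1)), E)) : bd E (ssx σ) = 0 := by
  rw [bd, chainLift_ssx, bdAux]

theorem bd_succ {n : ℕ} (σ : C(stdSimplex ℝ (Fin (n + 1 + 1)), E)) :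
    bd E (ssx σ) = ∑ i : Fin (n + 2), (-1 : ℚ) ^ (i : ℕ) • ssx (σ.comp (face i)) := by
  rw [bd, chainLift_ssx, bdAux]

theorem bd_mem_sub {P : Set E} {x : SChain E} (hx : x ∈ sub P) : bd E x ∈ sub P := by
  refine map_mem_of_mem_sub (fun n σ hσ ↦ ?_) hx
  cases n with
  | zero => rw [bd_zero]; exact zero_mem _
  | succ n =>
    rw [bd_succ]
    exact Submodule.sum_mem _ fun i _ ↦ Submodule.smul_mem _ _ (ssx_mem_sub fun t ↦ hσ _)

/-- The map on chains induced by a continuous map. -/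
def push (f : C(E, E')) : SChain E →ₗ[ℚ] SChain E' := chainLift fun _ σ ↦ ssx (f.comp σ)

theorem push_ssx (f : C(E, E')) {n : ℕ} (σ : C(stdSimplex ℝ (Fin (n + 1)), E)) :
    push f (ssx σ) = ssx (f.comp σ) := by
  rw [push, chainLift_ssx]

theorem push_bd (f : C(E, E')) (x : SChain E) : push f (bd E x) = bd E' (push f x) := by
  suffices h : push f ∘ₗ bd E = bd E' ∘ₗ push f from LinearMap.congr_fun h x
  refine ssx_hom_ext fun n σ ↦ ?_
  simp only [LinearMap.comp_apply, push_ssx]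
  cases n with
  | zero => simp only [bd_zero, map_zero]
  | succ n => simp only [bd_succ, map_sum, map_smul, push_ssx, ContinuousMap.comp_assoc]

theorem push_mem_sub {f : C(E, E')} {P : Set E} {Q : Set E'} (h : ∀ x ∈ P, f x ∈ Q)
    {x : SChain E} (hx : x ∈ sub P) : push f x ∈ sub Q := by
  refine map_mem_of_mem_sub (fun n σ hσ ↦ ?_) hx
  rw [push_ssx]
  exact ssx_mem_sub fun t ↦ h _ (hσ t)

variable [TopologicalSpace D] [TopologicalSpace D'] [TopConvex D] [TopConvex D']

/-- The value of the realization on a tuple. -/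
def realizeAux (φ : C(D, E)) : ∀ n : ℕ, (Fin n → D) → SChain E
  | 0, _ => 0
  | _ + 1, v => ssx (φ.comp (aff v))

/-- The chain map that sends a tuple to the image of the affine simplex that it spans. -/
def realize (φ : C(D, E)) : TChain D →ₗ[ℚ] SChain E := tupLift (realizeAux φ)

theorem realize_zero (φ : C(D, E)) (v : Fin 0 → D) : realize φ (tup v) = 0 := by
  rw [realize, tupLift_tup, realizeAux]

theorem realize_succ (φ : C(D, E)) {n : ℕ} (v : Fin (n + 1) → D) :
    realize φ (tup v) = ssx (φ.comp (aff v)) := by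
  rw [realize, tupLift_tup, realizeAux]

/-- Killing the empty tuple is what reconciles the augmented complex of tuples with singular chains,
where the boundary of a point is zero. -/
theorem realize_tbd (φ : C(D, E)) (x : TChain D) :
    realize φ (tbd D x) = bd E (realize φ x) := by
  suffices h : realize φ ∘ₗ tbd D = bd E ∘ₗ realize φ from LinearMap.congr_fun h x
  refine tup_hom_ext fun n v ↦ ?_
  simp only [LinearMap.comp_apply]
  match n with
  | 0 => rw [tbd_zero, realize_zero, map_zero, map_zero]
  | 1 => simp only [tbd_succ, map_sum, map_smul, realize_zero, realize_succ, bd_zero, smul_zero,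
      Finset.sum_const_zero]
  | n + 2 => simp only [tbd_succ, map_sum, map_smul, realize_succ, bd_succ,
      ContinuousMap.comp_assoc, aff_comp_face]

theorem realize_vertices {n : ℕ} (σ : C(stdSimplex ℝ (Fin (n + 1)), E)) :
    realize σ (tup stdSimplex.vertex) = ssx σ := by
  rw [realize_succ, aff_vertices, ContinuousMap.comp_id]

theorem realize_tmap (φ : C(D', E)) {α : C(D, D')} (hα : IsAff α) (x : TChain D) :
    realize φ (tmap α x) = realize (φ.comp α) x := by
  suffices h : realize φ ∘ₗ tmap α = realize (φ.comp α) from LinearMap.congr_fun h x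
  refine tup_hom_ext fun n v ↦ ?_
  simp only [LinearMap.comp_apply, tmap_tup]
  cases n with
  | zero => rw [realize_zero, realize_zero]
  | succ n => rw [realize_succ, realize_succ, ContinuousMap.comp_assoc, hα.comp_aff]

theorem realize_mem_sub {φ : C(D, E)} {P : Set E} (h : ∀ d, φ d ∈ P) (x : TChain D) :
    realize φ x ∈ sub P := by
  induction x using Finsupp.induction_linear with
  | zero => rw [map_zero]; exact zero_mem _
  | add x y hx hy => rw [map_add]; exact add_mem hx hy
  | single p c =>
    rw [show Finsupp.single p c = c • tup p.2 by simp [tup], map_smul]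
    refine Submodule.smul_mem _ _ ?_
    obtain ⟨n, v⟩ := p
    cases n with
    | zero => rw [realize_zero]; exact zero_mem _
    | succ n => rw [realize_succ]; exact ssx_mem_sub fun t ↦ h _

theorem bd_bd (x : SChain E) : bd E (bd E x) = 0 := by
  suffices h : bd E ∘ₗ bd E = 0 from LinearMap.congr_fun h x
  refine ssx_hom_ext fun n σ ↦ ?_
  simp only [LinearMap.comp_apply]
  rw [← realize_vertices, ← realize_tbd, ← realize_tbd, tbd_tbd, map_zero, LinearMap.zero_apply]

/-! ### Subdivision of singular chains -/

/-- The operator on singular chains defined by a family of operators on tuples. -/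
def natOp (θ : ∀ n, TChain (stdSimplex ℝ (Fin n)) →ₗ[ℚ] TChain (stdSimplex ℝ (Fin n))) :
    SChain E →ₗ[ℚ] SChain E :=
  chainLift fun n σ ↦ realize σ (θ (n + 1) (tup stdSimplex.vertex))

theorem natOp_ssx (θ : ∀ n, TChain (stdSimplex ℝ (Fin n)) →ₗ[ℚ] TChain (stdSimplex ℝ (Fin n)))
    {n : ℕ} (σ : C(stdSimplex ℝ (Fin (n + 1)), E)) :
    natOp θ (ssx σ) = realize σ (θ (n + 1) (tup stdSimplex.vertex)) := by
  rw [natOp, chainLift_ssx]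

theorem natOp_mem_sub
    (θ : ∀ n, TChain (stdSimplex ℝ (Fin n)) →ₗ[ℚ] TChain (stdSimplex ℝ (Fin n)))
    {P : Set E} {x : SChain E} (hx : x ∈ sub P) : natOp θ x ∈ sub P := by
  refine map_mem_of_mem_sub (fun n σ hσ ↦ ?_) hx
  rw [natOp_ssx]
  exact realize_mem_sub hσ _

variable (E) in
/-- Barycentric subdivision of singular chains. -/
def subdivide : SChain E →ₗ[ℚ] SChain E := natOp fun _ ↦ sd _

variable (E) in
/-- The homotopy between the identity and the subdivision of singular chains. -/
def subdivideHtpy : SChain E →ₗ[ℚ] SChain E := natOp fun _ ↦ sdHtpy _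

/-- Affine maps commute with `sd`, so the definition on the vertices of a standard simplex
propagates to all affine simplices. Since each `σ` is the realization of its vertex tuple,
identities for tuples transfer to singular chains. -/
theorem subdivide_realize (φ : C(D, E)) (x : TChain D) :
    subdivide E (realize φ x) = realize φ (sd D x) := by
  suffices h : subdivide E ∘ₗ realize φ = realize φ ∘ₗ sd D from LinearMap.congr_fun h x
  refine tup_hom_ext fun n v ↦ ?_
  simp only [LinearMap.comp_apply]
  cases n with
  | zero => rw [sd_zero, realize_zero, map_zero]
  | succ n =>
    rw [realize_succ, subdivide, natOp_ssx, ← realize_tmap _ (isAff_aff v),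
      (isAff_aff v).tmap_sd, tmap_tup, aff_comp_vertex]

theorem subdivideHtpy_realize (φ : C(D, E)) (x : TChain D) :
    subdivideHtpy E (realize φ x) = realize φ (sdHtpy D x) := by
  suffices h : subdivideHtpy E ∘ₗ realize φ = realize φ ∘ₗ sdHtpy D from LinearMap.congr_fun h x
  refine tup_hom_ext fun n v ↦ ?_
  simp only [LinearMap.comp_apply]
  cases n with
  | zero => rw [sdHtpy_zero, realize_zero, map_zero, map_zero]
  | succ n =>
    rw [realize_succ, subdivideHtpy, natOp_ssx, ← realize_tmap _ (isAff_aff v),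
      (isAff_aff v).tmap_sdHtpy, tmap_tup, aff_comp_vertex]

theorem bd_subdivide (x : SChain E) : bd E (subdivide E x) = subdivide E (bd E x) := by
  suffices h : bd E ∘ₗ subdivide E = subdivide E ∘ₗ bd E from LinearMap.congr_fun h x
  refine ssx_hom_ext fun n σ ↦ ?_
  simp only [LinearMap.comp_apply]
  rw [← realize_vertices, subdivide_realize, ← realize_tbd, ← realize_tbd, subdivide_realize,
    tbd_sd]

theorem bd_subdivideHtpy (x : SChain E) :
    bd E (subdivideHtpy E x) = x - subdivide E x - subdivideHtpy E (bd E x) := by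
  suffices h : bd E ∘ₗ subdivideHtpy E =
    LinearMap.id - subdivide E - subdivideHtpy E ∘ₗ bd E from LinearMap.congr_fun h x
  refine ssx_hom_ext fun n σ ↦ ?_
  simp only [LinearMap.comp_apply, LinearMap.sub_apply, LinearMap.id_apply]
  rw [← realize_vertices, subdivide_realize, subdivideHtpy_realize, ← realize_tbd, ← realize_tbd,
    subdivideHtpy_realize, tbd_sdHtpy, map_sub, map_sub]

end SingularChains

/-! ### Small simplices -/

/-! ### Mesh of iterated barycentric subdivisions. -/

section Mesh

theorem dist_comb_le {k N : ℕ} {v : Fin k → stdSimplex ℝ (Fin N)} {p : stdSimplex ℝ (Fin N)}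
    {R : ℝ} (h : ∀ i, dist (v i) p ≤ R) (t : stdSimplex ℝ (Fin k)) : dist (aff v t) p ≤ R :=
  (convex_closedBall (p : Fin N → ℝ) R).sum_mem (t := Finset.univ) (w := t)
    (z := fun i ↦ (v i : Fin N → ℝ)) (fun i _ ↦ t.2.1 i) t.2.2 (fun i _ ↦ h i)

/-- The vector from `v j` to the barycenter is the mean of the `k + 1` differences `v i - v j`, one
of which vanishes. -/
theorem dist_bary_le {k N : ℕ} {v : Fin (k + 1) → stdSimplex ℝ (Fin N)} {R : ℝ}
    (h : ∀ i j, dist (v i) (v j) ≤ R) (j : Fin (k + 1)) :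
    dist (bary v) (v j) ≤ k / (k + 1) * R := by
  have hk : (k + 1 : ℝ) ≠ 0 := by positivity
  have h1 : (bary v).1 - (v j).1 = ∑ i, (k + 1 : ℝ)⁻¹ • ((v i).1 - (v j).1) := by
    rw [← Finset.smul_sum, Finset.sum_sub_distrib, smul_sub, Finset.sum_const, Finset.card_univ,
      Fintype.card_fin, ← Nat.cast_smul_eq_nsmul ℝ, smul_smul, Nat.cast_succ,
      inv_mul_cancel₀ hk, one_smul, Finset.smul_sum]
    congr 1
    change ∑ i, (Fintype.card (Fin (k + 1)) : ℝ)⁻¹ • (v i).1 = _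
    simp
  rw [Subtype.dist_eq, dist_eq_norm, h1, Fin.sum_univ_succAbove _ j]
  simp only [sub_self, smul_zero, zero_add]
  refine (norm_sum_le _ _).trans ?_
  have : ∀ i : Fin k, ‖(k + 1 : ℝ)⁻¹ • ((v (j.succAbove i)).1 - (v j).1)‖ ≤ (k + 1 : ℝ)⁻¹ * R := by
    intro i
    rw [norm_smul, Real.norm_of_nonneg (by positivity), ← dist_eq_norm]
    exact mul_le_mul_of_nonneg_left (h _ _) (by positivity)
  refine (Finset.sum_le_sum fun i _ ↦ this i).trans ?_
  rw [Finset.sum_const, Finset.card_univ, Fintype.card_fin, nsmul_eq_mul]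
  apply le_of_eq
  field_simp

/-- The chains of tuples of length `k` in `C` with distances at most `R`. -/
def meshLE {N : ℕ} (C : Set (stdSimplex ℝ (Fin N))) (R : ℝ) (k : ℕ) :
    Submodule ℚ (TChain (stdSimplex ℝ (Fin N))) :=
  Finsupp.supported ℚ ℚ {p | p.1 = k ∧ (∀ i, p.2 i ∈ C) ∧ ∀ i j, dist (p.2 i) (p.2 j) ≤ R}

theorem meshLE_mono {N : ℕ} {C C' : Set (stdSimplex ℝ (Fin N))} (h : C ⊆ C') (R : ℝ) (k : ℕ) :
    meshLE C R k ≤ meshLE C' R k :=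
  Finsupp.supported_mono fun _ hp ↦ ⟨hp.1, fun i ↦ h (hp.2.1 i), hp.2.2⟩

theorem map_mem_of_mem_meshLE {N : ℕ} {C : Set (stdSimplex ℝ (Fin N))} {R : ℝ} {k : ℕ}
    {M : Type} [AddCommGroup M] [Module ℚ M] {f : TChain (stdSimplex ℝ (Fin N)) →ₗ[ℚ] M}
    {q : Submodule ℚ M}
    (h : ∀ v : Fin k → stdSimplex ℝ (Fin N), (∀ i, v i ∈ C) → (∀ i j, dist (v i) (v j) ≤ R) →
      f (tup v) ∈ q) {x : TChain (stdSimplex ℝ (Fin N))} (hx : x ∈ meshLE C R k) : f x ∈ q := by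
  rw [meshLE, Finsupp.supported_eq_span_single] at hx
  refine (Submodule.span_le (p := q.comap f)).2 ?_ hx
  rintro _ ⟨⟨n, v⟩, ⟨rfl, hp⟩, rfl⟩
  exact h v hp.1 hp.2

theorem cone_mem_meshLE {N : ℕ} {C : Set (stdSimplex ℝ (Fin N))} {R : ℝ} (hR : 0 ≤ R) {k : ℕ}
    {b : stdSimplex ℝ (Fin N)} (hb : b ∈ C) (hd : ∀ p ∈ C, dist b p ≤ R)
    {x : TChain (stdSimplex ℝ (Fin N))} (hx : x ∈ meshLE C R k) :
    cone b x ∈ meshLE C R (k + 1) := by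
  refine map_mem_of_mem_meshLE (fun v hv hvd ↦ ?_) hx
  rw [cone_tup]
  refine Finsupp.single_mem_supported ℚ 1 ⟨rfl, ?_, ?_⟩
  · exact Fin.cases hb hv
  · refine Fin.cases (Fin.cases ?_ fun j ↦ ?_) fun i ↦ Fin.cases ?_ fun j ↦ ?_
    · simpa using hR
    · simpa using hd _ (hv j)
    · simpa [dist_comm] using hd _ (hv i)
    · simpa using hvd i j

/-- The hull `Set.range (aff v)` is carried through the recursion because coning requires a bound on
the distance from the barycenter to all vertices of the subdivided faces. The ratio is fixed at `n /
(n + 1)`, which dominates the ratios of all lower dimensions. -/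
theorem sd_mem_meshLE {N n : ℕ} {R : ℝ} (hR : 0 ≤ R) : ∀ {k : ℕ}
    {v : Fin k → stdSimplex ℝ (Fin N)}, k ≤ n + 1 → (∀ i j, dist (v i) (v j) ≤ R) →
    sd _ (tup v) ∈ meshLE (Set.range (aff v)) (n / (n + 1) * R) k
  | 0, v, _, _ => by
    rw [sd_zero]
    exact Finsupp.single_mem_supported ℚ 1 ⟨rfl, fun i ↦ i.elim0, fun i ↦ i.elim0⟩
  | k + 1, v, hk, h => by
    have hR' : 0 ≤ (n / (n + 1) : ℝ) * R := by positivity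
    have hq : (k / (k + 1) : ℝ) ≤ n / (n + 1) := by
      have : (k : ℝ) ≤ n := by exact_mod_cast Nat.le_of_succ_le_succ hk
      rw [div_le_div_iff₀ (by positivity) (by positivity)]
      nlinarith
    rw [sd_succ]
    refine cone_mem_meshLE hR' (Set.mem_range_self stdSimplex.barycenter) ?_ ?_
    · rintro _ ⟨t, rfl⟩
      rw [dist_comm]
      refine dist_comb_le (fun i ↦ ?_) t
      rw [dist_comm]
      exact (dist_bary_le h i).trans (mul_le_mul_of_nonneg_right hq hR)
    · rw [tbd_succ, map_sum]
      refine Submodule.sum_mem _ fun i _ ↦ ?_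
      rw [map_smul]
      refine Submodule.smul_mem _ _ (meshLE_mono ?_ _ _
        (sd_mem_meshLE hR (by omega) fun i j ↦ h _ _))
      rw [← aff_comp_face]
      rintro _ ⟨t, rfl⟩
      exact ⟨_, rfl⟩

theorem iterate_sd_mem_meshLE {n : ℕ} (j : ℕ) :
    ((sd (stdSimplex ℝ (Fin (n + 1))))^[j]) (tup stdSimplex.vertex) ∈
      meshLE Set.univ ((n / (n + 1) : ℝ) ^ j) (n + 1) := by
  induction j with
  | zero =>
    refine Finsupp.single_mem_supported ℚ 1 ⟨rfl, fun i ↦ trivial, fun i j ↦ ?_⟩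
    rw [pow_zero]
    exact (Metric.dist_le_diam_of_mem (bounded_stdSimplex (Fin (n + 1)))
      (stdSimplex.vertex i).2 (stdSimplex.vertex j).2).trans diam_stdSimplex_le
  | succ j ih =>
    rw [Function.iterate_succ_apply', pow_succ']
    exact map_mem_of_mem_meshLE (fun v _ hd ↦ meshLE_mono (Set.subset_univ _) _ _
      (sd_mem_meshLE (by positivity) le_rfl hd)) ih

end Mesh

/-! ### Replacing chains by small chains for a cover by two open sets. -/

section Small

variable {E : Type} [TopologicalSpace E]

theorem subdivide_mem_sup {P Q : Set E} {x : SChain E} (hx : x ∈ sub P ⊔ sub Q) :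
    subdivide E x ∈ sub P ⊔ sub Q := by
  obtain ⟨y, hy, z, hz, rfl⟩ := Submodule.mem_sup.1 hx
  rw [map_add]
  exact Submodule.add_mem_sup (natOp_mem_sub _ hy) (natOp_mem_sub _ hz)

theorem iterate_subdivide_mem_sup {P Q : Set E} {x : SChain E} (hx : x ∈ sub P ⊔ sub Q) (k : ℕ) :
    (subdivide E)^[k] x ∈ sub P ⊔ sub Q := by
  induction k with
  | zero => exact hx
  | succ k ih => rw [Function.iterate_succ_apply']; exact subdivide_mem_sup ih

theorem exists_iterate_subdivide_ssx_mem {P O₁ O₂ : Set E} (h₁ : IsOpen O₁) (h₂ : IsOpen O₂)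
    (hP : P ⊆ O₁ ∪ O₂) {n : ℕ} {σ : C(stdSimplex ℝ (Fin (n + 1)), E)} (hσ : ∀ t, σ t ∈ P) :
    ∃ k, (subdivide E)^[k] (ssx σ) ∈ sub (P ∩ O₁) ⊔ sub (P ∩ O₂) := by
  have hc : IsCompact (Set.univ : Set (stdSimplex ℝ (Fin (n + 1)))) :=
    isCompact_iff_isCompact_univ.1 (isCompact_stdSimplex ℝ _)
  obtain ⟨δ, hδ, hL⟩ := lebesgue_number_lemma_of_metric (ι := Bool)
    (c := fun b ↦ σ ⁻¹' (bif b then O₁ else O₂)) hc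
    (by rintro (_ | _); exacts [h₂.preimage σ.continuous, h₁.preimage σ.continuous])
    (fun t _ ↦ by
      rcases hP (hσ t) with h | h
      exacts [Set.mem_iUnion.2 ⟨true, h⟩, Set.mem_iUnion.2 ⟨false, h⟩])
  obtain ⟨k, hk⟩ := exists_pow_lt_of_lt_one hδ
    (show (n / (n + 1) : ℝ) < 1 by rw [div_lt_one (by positivity)]; linarith)
  refine ⟨k, ?_⟩
  have hit : ∀ x, (subdivide E)^[k] (realize σ x) = realize σ ((sd _)^[k] x) := by
    clear hk
    induction k with
    | zero => intro x; rfl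
    | succ k ih =>
      intro x
      rw [Function.iterate_succ_apply, Function.iterate_succ_apply, subdivide_realize, ih]
  rw [← realize_vertices, hit]
  refine map_mem_of_mem_meshLE (fun v _ hv ↦ ?_) (iterate_sd_mem_meshLE k)
  rw [realize_succ]
  obtain ⟨b, hb⟩ := hL (v 0) trivial
  -- The mesh is below the Lebesgue number `δ`, so the whole simplex lies in the ball around its
  -- first vertex and hence in one member of the cover.
  have key : ∀ t, aff v t ∈ Metric.ball (v 0) δ := fun t ↦
    (dist_comb_le (fun i ↦ hv i 0) t).trans_lt hk
  cases b with
  | true => exact Submodule.mem_sup_left (ssx_mem_sub fun t ↦ ⟨hσ _, hb (key t)⟩)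
  | false => exact Submodule.mem_sup_right (ssx_mem_sub fun t ↦ ⟨hσ _, hb (key t)⟩)

theorem exists_iterate_subdivide_mem {P O₁ O₂ : Set E} (h₁ : IsOpen O₁) (h₂ : IsOpen O₂)
    (hP : P ⊆ O₁ ∪ O₂) {x : SChain E} (hx : x ∈ sub P) :
    ∃ k, (subdivide E)^[k] x ∈ sub (P ∩ O₁) ⊔ sub (P ∩ O₂) := by
  have hit : ∀ (k : ℕ) (y : SChain E), (subdivide E)^[k] y = ((subdivide E) ^ k) y := fun k y ↦ by
    rw [Module.End.pow_apply]
  rw [sub_eq_span] at hx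
  induction hx using Submodule.span_induction with
  | mem x hx =>
    obtain ⟨p, hp, rfl⟩ := hx
    exact exists_iterate_subdivide_ssx_mem h₁ h₂ hP hp
  | zero => exact ⟨0, zero_mem _⟩
  | add x y _ _ hx hy =>
    obtain ⟨k, hk⟩ := hx
    obtain ⟨l, hl⟩ := hy
    refine ⟨l + k, ?_⟩
    rw [hit, map_add, ← hit, ← hit, Function.iterate_add_apply, add_comm l k,
      Function.iterate_add_apply]
    exact add_mem (iterate_subdivide_mem_sup hk l) (iterate_subdivide_mem_sup hl k)
  | smul c x _ hx =>
    obtain ⟨k, hk⟩ := hx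
    refine ⟨k, ?_⟩
    rw [hit, map_smul, ← hit]
    exact Submodule.smul_mem _ _ hk

/-- A cycle of small simplices that bounds, bounds a chain of small simplices. -/
theorem exists_bd_eq_of_small {P O₁ O₂ : Set E} (h₁ : IsOpen O₁) (h₂ : IsOpen O₂)
    (hP : P ⊆ O₁ ∪ O₂) {w : SChain E} (hw : w ∈ sub P)
    (hz : bd E w ∈ sub (P ∩ O₁) ⊔ sub (P ∩ O₂)) :
    ∃ s ∈ sub (P ∩ O₁) ⊔ sub (P ∩ O₂), bd E s = bd E w := by
  obtain ⟨k, hk⟩ := exists_iterate_subdivide_mem h₁ h₂ hP hw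
  clear hw
  induction k generalizing w with
  | zero => exact ⟨w, hk, rfl⟩
  | succ k ih =>
    rw [Function.iterate_succ_apply] at hk
    obtain ⟨s, hs, h⟩ := ih (by rw [bd_subdivide]; exact subdivide_mem_sup hz) hk
    -- The chain `s` has the boundary of the subdivided `w`. The homotopy applied to the cycle `bd E
    -- w` corrects the difference, and it stays small because `bd E w` is small.
    refine ⟨s + subdivideHtpy E (bd E w), add_mem hs ?_, ?_⟩
    · obtain ⟨y, hy, z, hz, h⟩ := Submodule.mem_sup.1 hz
      rw [← h, map_add]
      exact Submodule.add_mem_sup (natOp_mem_sub _ hy) (natOp_mem_sub _ hz)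
    · rw [map_add, h, bd_subdivideHtpy, bd_bd, bd_subdivide]
      simp

end Small

/-! ### Homotopy invariance -/

section Homotopy

variable {E : Type} [TopologicalSpace E]

/-- The track of a singular simplex under a deformation, if it is continuous. -/
def track (H : E × Interval → E) {n : ℕ} (σ : C(stdSimplex ℝ (Fin (n + 1)), E)) :
    C(stdSimplex ℝ (Fin (n + 1)) × Interval, E) :=
  open Classical in
  -- A deformation is only required to be continuous over `P`. The default track for other simplices
  -- makes the prism operator total and has no effect on chains in `P`.
  if h : Continuous fun q : stdSimplex ℝ (Fin (n + 1)) × Interval ↦ H (σ q.1, q.2) then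
    ⟨_, h⟩ else σ.comp ⟨Prod.fst, continuous_fst⟩

theorem track_apply {H : E × Interval → E} {P : Set E} (hH : ContinuousOn H (P ×ˢ Set.univ))
    {n : ℕ} {σ : C(stdSimplex ℝ (Fin (n + 1)), E)} (hσ : ∀ t, σ t ∈ P)
    (q : stdSimplex ℝ (Fin (n + 1)) × Interval) : track H σ q = H (σ q.1, q.2) := by
  have h : Continuous fun q : stdSimplex ℝ (Fin (n + 1)) × Interval ↦ H (σ q.1, q.2) :=
    hH.comp_continuous (by fun_prop) fun q ↦ ⟨hσ _, trivial⟩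
  rw [track, dif_pos h]
  rfl

/-- The prism operator of a deformation. -/
def prismOp (H : E × Interval → E) : SChain E →ₗ[ℚ] SChain E :=
  chainLift fun _ σ ↦ realize (track H σ) (prism _ (tup stdSimplex.vertex))

/-- A deformation of `P` within `P` moves a cycle in `P` by a boundary in `P`. -/
theorem push_sub_mem_map_bd {P : Set E} {H : E × Interval → E} {ρ : C(E, E)}
    (hH : ContinuousOn H (P ×ˢ Set.univ)) (hP : ∀ x ∈ P, ∀ a, H (x, a) ∈ P)
    (h0 : ∀ x ∈ P, H (x, stdSimplex.vertex 0) = x)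
    (h1 : ∀ x ∈ P, H (x, stdSimplex.vertex 1) = ρ x)
    {x : SChain E} (hx : x ∈ sub P) (hc : bd E x = 0) :
    push ρ x - x ∈ (sub P).map (bd E) := by
  have hop : ∀ {n : ℕ} (σ : C(stdSimplex ℝ (Fin (n + 1)), E)),
      prismOp H (ssx σ) = realize (track H σ) (prism _ (tup stdSimplex.vertex)) := fun σ ↦ by
    rw [prismOp, chainLift_ssx]
  have hend : ∀ (e : Fin 2) {n : ℕ} (σ : C(stdSimplex ℝ (Fin (n + 1)), E)) (τ : C(_, E)),
      (∀ t, track H σ (t, stdSimplex.vertex e) = τ t) →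
      realize (track H σ) (tend _ e (tup stdSimplex.vertex)) = ssx τ := by
    intro e n σ τ h
    rw [tend, tmap_tup, realize_succ]
    congr 2
    ext t
    rw [← h t]
    change track H σ (aff (stdSimplex.vertex : Fin (n + 1) → _) t,
      aff (fun _ : Fin (n + 1) ↦ stdSimplex.vertex e) t) = _
    rw [aff_vertices]
    congr 2
    ext j
    change simplexComb t _ j = _
    rw [simplexComb_apply, ← Finset.sum_mul, stdSimplex.sum_eq_one, one_mul]
  refine ⟨prismOp H x, map_mem_of_mem_sub (fun n σ hσ ↦ ?_) hx, ?_⟩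
  · rw [hop]
    exact realize_mem_sub (fun q ↦ by rw [track_apply hH hσ]; exact hP _ (hσ _) _) _
  suffices h : (bd E ∘ₗ prismOp H) x =
      (push ρ - LinearMap.id - prismOp H ∘ₗ bd E : SChain E →ₗ[ℚ] SChain E) x by
    simpa [hc] using h
  refine eqOn_sub (fun n σ hσ ↦ ?_) hx
  simp only [LinearMap.comp_apply, LinearMap.sub_apply, LinearMap.id_apply]
  rw [hop, ← realize_tbd, tbd_prism, map_sub, map_sub, push_ssx,
    hend 1 σ (ρ.comp σ) fun t ↦ (track_apply hH hσ _).trans (h1 _ (hσ t)),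
    hend 0 σ σ fun t ↦ (track_apply hH hσ _).trans (h0 _ (hσ t))]
  congr 1
  cases n with
  | zero =>
    -- The tuple boundary of a vertex is the empty tuple, whose prism is zero.
    rw [bd_zero, map_zero, tbd_succ]
    simp [prism_zero]
  | succ n =>
    rw [bd_succ, tbd_succ, map_sum, map_sum, map_sum]
    refine Finset.sum_congr rfl fun i _ ↦ ?_
    rw [map_smul, map_smul, map_smul, hop]
    congr 1
    -- Naturality of the prism under the affine face inclusion identifies the prism over the `i`-th
    -- face with the prism operator on `σ.comp (face i)`.
    have hi : (stdSimplex.vertex : Fin (n + 2) → stdSimplex ℝ (Fin (n + 2))) ∘ i.succAbove =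
        face i ∘ stdSimplex.vertex := by
      rw [face, aff_comp_vertex]; rfl
    have ha : IsAff ((face i : C(stdSimplex ℝ (Fin (n + 1)), _)).prodMap
        (ContinuousMap.id Interval)) := by
      intro k t v
      exact Prod.ext (isAff_aff _ _ _ _) rfl
    rw [hi, ← tmap_tup, ← tmap_prism]
    have := realize_tmap (track H σ) ha (prism _ (tup stdSimplex.vertex))
    refine this.trans (congrArg (fun φ ↦ realize φ _) (ContinuousMap.ext fun q ↦ ?_))
    rw [ContinuousMap.comp_apply, track_apply hH hσ,
      track_apply (σ := σ.comp (face i)) hH fun t ↦ hσ _]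
    rfl

end Homotopy

/-! ### Homology ranks of differential vector spaces -/

section Rank

theorem rank_range_le_of_ker_le {M N N' : Type} [AddCommGroup M] [Module ℚ M] [AddCommGroup N]
    [Module ℚ N] [AddCommGroup N'] [Module ℚ N'] {f : M →ₗ[ℚ] N} {g : M →ₗ[ℚ] N'}
    (h : LinearMap.ker f ≤ LinearMap.ker g) :
    Module.rank ℚ (LinearMap.range g) ≤ Module.rank ℚ (LinearMap.range f) := by
  rw [← Submodule.range_liftQ (LinearMap.ker f) g h, ← f.quotKerEquivRange.rank_eq]
  exact rank_range_le _

variable {V : Type} [AddCommGroup V] [Module ℚ V]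

/-- The homology of the subspace `S` of a vector space with differential `d`. -/
abbrev SubHomology (d : V →ₗ[ℚ] V) (S : Submodule ℚ V) : Type :=
  ↥(LinearMap.ker d ⊓ S) ⧸ (S.map d).comap (LinearMap.ker d ⊓ S).subtype

theorem mkQ_subHomology_eq_zero {d : V →ₗ[ℚ] V} {S : Submodule ℚ V}
    {x : ↥(LinearMap.ker d ⊓ S)} :
    ((S.map d).comap (LinearMap.ker d ⊓ S).subtype).mkQ x = 0 ↔ x.1 ∈ S.map d := by
  rw [Submodule.mkQ_apply, Submodule.Quotient.mk_eq_zero]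
  rfl

/-- Points detected by functionals that vanish on boundaries give independent classes. -/
theorem card_le_rank_subHomology {d : V →ₗ[ℚ] V} {S : Submodule ℚ V} {ι : Type} [Fintype ι]
    [DecidableEq ι] (p : ι → V) (hp : ∀ i, p i ∈ LinearMap.ker d ⊓ S) (l : ι → V →ₗ[ℚ] ℚ)
    (hl : ∀ i, ∀ x ∈ S, l i (d x) = 0) (hlp : ∀ i j, l i (p j) = if i = j then 1 else 0) :
    (Fintype.card ι : Cardinal) ≤ Module.rank ℚ (SubHomology d S) := by
  let Λ : ↥(LinearMap.ker d ⊓ S) →ₗ[ℚ] ι → ℚ := LinearMap.pi fun i ↦ l i ∘ₗ Submodule.subtype _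
  have hΛ : (S.map d).comap (LinearMap.ker d ⊓ S).subtype ≤ LinearMap.ker Λ := by
    rintro x ⟨y, hy, hxy⟩
    refine funext fun i ↦ ?_
    change l i x.1 = 0
    rw [show x.1 = d y from hxy.symm, hl i y hy]
  have hs : Function.Surjective (Submodule.liftQ _ Λ hΛ) := by
    intro f
    refine ⟨Submodule.Quotient.mk (∑ j, f j • (⟨p j, hp j⟩ : ↥(LinearMap.ker d ⊓ S))), ?_⟩
    rw [Submodule.liftQ_apply, map_sum]
    ext i
    simp [Λ, hlp, Finset.sum_apply]
  have := LinearMap.rank_le_of_surjective _ hs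
  rwa [rank_fun'] at this

/-- A chain map does not decrease homology if it reflects boundaries. -/
theorem rank_subHomology_le_of_reflect {V' : Type} [AddCommGroup V'] [Module ℚ V']
    {d : V →ₗ[ℚ] V} {d' : V' →ₗ[ℚ] V'} {S : Submodule ℚ V} {S' : Submodule ℚ V'}
    (J : V →ₗ[ℚ] V') (hJ : Function.Injective J) (hd : ∀ x, J (d x) = d' (J x))
    (hS : S.map J = S') :
    Module.rank ℚ (SubHomology d' S') ≤ Module.rank ℚ (SubHomology d S) := by
  have hm : ∀ x ∈ LinearMap.ker d ⊓ S, J x ∈ LinearMap.ker d' ⊓ S' := fun x hx ↦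
    ⟨LinearMap.mem_ker.2 (by rw [← hd, LinearMap.mem_ker.1 hx.1, map_zero]),
      hS ▸ Submodule.mem_map_of_mem hx.2⟩
  let F : ↥(LinearMap.ker d ⊓ S) →ₗ[ℚ] SubHomology d' S' :=
    Submodule.mkQ _ ∘ₗ J.restrict hm
  have hF : (S.map d).comap (LinearMap.ker d ⊓ S).subtype ≤ LinearMap.ker F := by
    rintro x ⟨y, hy, hxy⟩
    refine mkQ_subHomology_eq_zero.2 ⟨J y, hS ▸ Submodule.mem_map_of_mem hy, ?_⟩
    rw [← hd, hxy]
    rfl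
  refine LinearMap.rank_le_of_surjective (Submodule.liftQ _ F hF) fun y ↦ ?_
  obtain ⟨⟨y, hy⟩, rfl⟩ := Submodule.mkQ_surjective _ y
  obtain ⟨x, hx, rfl⟩ : y ∈ S.map J := hS ▸ hy.2
  have hx0 : d x = 0 := hJ (by rw [hd, map_zero]; exact hy.1)
  exact ⟨Submodule.Quotient.mk ⟨x, hx0, hx⟩, rfl⟩

/-- The Mayer–Vietoris inequality: if two subspaces `A`, `B` with excisive sum are retracts of `T`
in homology, then the homology of `A ⊓ B` is at most as large as that of `T`. -/
theorem rank_subHomology_inf_le {d : V →ₗ[ℚ] V} (hdd : ∀ x, d (d x) = 0) {A B T : Submodule ℚ V}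
    (hA : A ≤ T) (hB : B ≤ T) (hdA : ∀ x ∈ A, d x ∈ A) (hdB : ∀ x ∈ B, d x ∈ B)
    (hsmall : ∀ w ∈ T, d w ∈ A ⊔ B → ∃ s ∈ A ⊔ B, d s = d w)
    {p q : V →ₗ[ℚ] V} (hpd : ∀ x, p (d x) = d (p x)) (hqd : ∀ x, q (d x) = d (q x))
    (hpT : ∀ x ∈ T, p x ∈ A) (hqT : ∀ x ∈ T, q x ∈ B)
    (hp : ∀ x ∈ A, d x = 0 → p x - x ∈ A.map d) (hq : ∀ x ∈ B, d x = 0 → q x - x ∈ B.map d) :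
    Module.rank ℚ (SubHomology d (A ⊓ B)) ≤ Module.rank ℚ (SubHomology d T) := by
  have hUT : A ⊓ B ≤ T := inf_le_left.trans hA
  -- the map induced by the inclusion
  let F : ↥(LinearMap.ker d ⊓ (A ⊓ B)) →ₗ[ℚ] SubHomology d T :=
    Submodule.mkQ _ ∘ₗ Submodule.inclusion (inf_le_inf_left _ hUT)
  have hF : ((A ⊓ B).map d).comap (LinearMap.ker d ⊓ (A ⊓ B)).subtype ≤ LinearMap.ker F :=
    fun x hx ↦ mkQ_subHomology_eq_zero.2 (Submodule.map_mono hUT hx)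
  let φ : SubHomology d (A ⊓ B) →ₗ[ℚ] SubHomology d T := Submodule.liftQ _ F hF
  -- the classes in `T` that come from `A` and `B`
  let L : Submodule ℚ (SubHomology d T) :=
    (((LinearMap.ker d ⊓ A) ⊔ (LinearMap.ker d ⊓ B)).comap
      (LinearMap.ker d ⊓ T).subtype).map (Submodule.mkQ _)
  have hφL : LinearMap.range φ ≤ L := by
    rintro _ ⟨x, rfl⟩
    obtain ⟨x, rfl⟩ := Submodule.mkQ_surjective _ x
    exact ⟨Submodule.inclusion (inf_le_inf_left _ hUT) x,
      Submodule.mem_sup_left ⟨x.2.1, x.2.2.1⟩, rfl⟩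
  -- pairs of chains with the same boundary
  let Z : Submodule ℚ (V × V) := (A.prod B) ⊓
    LinearMap.ker (d ∘ₗ LinearMap.fst ℚ V V - d ∘ₗ LinearMap.snd ℚ V V)
  have hZ : ∀ z : Z, d z.1.1 = d z.1.2 := fun z ↦ sub_eq_zero.1 z.2.2
  -- For a pair `(a, b)`, `P` is the class of the cycle `a - b` modulo `L` and `Q` is the class of
  -- the common boundary `d a = d b`. The inclusion of kernels `hPQ` encodes the connecting map as a
  -- map from the range of `P` onto the range of `Q`.
  let P : Z →ₗ[ℚ] SubHomology d T ⧸ L := L.mkQ ∘ₗ Submodule.mkQ _ ∘ₗ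
    ((LinearMap.fst ℚ V V - LinearMap.snd ℚ V V) ∘ₗ Z.subtype).codRestrict _ fun z ↦
      ⟨by simpa [sub_eq_zero] using hZ z, sub_mem (hA z.2.1.1) (hB z.2.1.2)⟩
  let Q : Z →ₗ[ℚ] SubHomology d (A ⊓ B) := Submodule.mkQ _ ∘ₗ
    (d ∘ₗ LinearMap.fst ℚ V V ∘ₗ Z.subtype).codRestrict _ fun z ↦
      ⟨hdd _, hdA _ z.2.1.1, by
        change d z.1.1 ∈ B
        rw [hZ]; exact hdB _ z.2.1.2⟩
  -- If `u` bounds `w` in `T`, then `p w` and `q w`, corrected by the homotopies `a` and `b`, bound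
  -- `u` inside `A` and inside `B`.
  have hker : LinearMap.ker φ ≤ LinearMap.range Q := by
    intro x hx
    obtain ⟨⟨u, hu0, huA, huB⟩, rfl⟩ := Submodule.mkQ_surjective _ x
    obtain ⟨w, hw, hdw⟩ : u ∈ T.map d := mkQ_subHomology_eq_zero.1 hx
    obtain ⟨a, ha, hda⟩ := hp u huA hu0
    obtain ⟨b, hb, hdb⟩ := hq u huB hu0
    have ea : d (p w - a) = u := by rw [map_sub, hda, ← hpd, hdw]; abel
    have eb : d (q w - b) = u := by rw [map_sub, hdb, ← hqd, hdw]; abel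
    refine ⟨⟨(p w - a, q w - b), ⟨sub_mem (hpT w hw) ha, sub_mem (hqT w hw) hb⟩, ?_⟩, ?_⟩
    · exact sub_eq_zero.2 (ea.trans eb.symm)
    · exact congrArg (Submodule.mkQ _) (Subtype.ext ea)
  have hPQ : LinearMap.ker P ≤ LinearMap.ker Q := by
    rintro ⟨⟨a, b⟩, ⟨ha, hb⟩, hab⟩ h
    replace hab : d a = d b := sub_eq_zero.1 hab
    obtain ⟨⟨y, hyT⟩, hy, hyab⟩ := (Submodule.Quotient.mk_eq_zero L).1 h
    obtain ⟨a', ha', b', hb', hy'⟩ := Submodule.mem_sup.1 hy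
    replace hy' : a' + b' = y := hy'
    obtain ⟨w, hw, hdw⟩ : y - (a - b) ∈ T.map d := by
      have := sub_eq_zero.2 hyab
      rw [LinearMap.comp_apply, ← map_sub] at this
      exact mkQ_subHomology_eq_zero.1 this
    have hmem : d w ∈ A ⊔ B := by
      rw [hdw, ← hy', show a' + b' - (a - b) = (a' - a) + (b' + b) by abel]
      exact Submodule.add_mem_sup (sub_mem ha'.2 ha) (add_mem hb'.2 hb)
    obtain ⟨s, hs, hds⟩ := hsmall w hw hmem
    obtain ⟨α, hα, β, hβ, rfl⟩ := Submodule.mem_sup.1 hs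
    -- After `w` is replaced by the small chain `α + β`, its boundary equation splits into an `A`
    -- side and a `B` side. Their common value lies in `A ⊓ B` and has boundary `d a`, so `Q`
    -- vanishes on the pair.
    have e : a - a' + d α = b + b' - d β := by
      have : d α + d β = a' + b' - (a - b) := by rw [← map_add, hds, hdw, hy']
      rw [← sub_eq_zero, show a - a' + d α - (b + b' - d β) = (d α + d β) - (a' + b' - (a - b))
        by abel, this, sub_self]
    refine mkQ_subHomology_eq_zero.2 ⟨a - a' + d α, ⟨?_, ?_⟩, ?_⟩
    · exact add_mem (sub_mem ha ha'.2) (hdA _ hα)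
    · rw [e]; exact sub_mem (add_mem hb hb'.2) (hdB _ hβ)
    · rw [map_add, map_sub, hdd, LinearMap.mem_ker.1 ha'.1, sub_zero, add_zero]
      rfl
  calc Module.rank ℚ (SubHomology d (A ⊓ B))
      = Module.rank ℚ (LinearMap.range φ) + Module.rank ℚ (LinearMap.ker φ) :=
        (LinearMap.rank_range_add_rank_ker φ).symm
    _ ≤ Module.rank ℚ L + Module.rank ℚ (SubHomology d T ⧸ L) :=
        add_le_add (Submodule.rank_mono hφL)
          ((Submodule.rank_mono hker).trans ((rank_range_le_of_ker_le hPQ).trans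
            (Submodule.rank_le _)))
    _ = Module.rank ℚ (SubHomology d T) := by
        rw [add_comm, Submodule.rank_quotient_add_rank]

end Rank

/-! ### Hyperbolic translations of the disc -/

section Translation

open scoped ComplexConjugate

/-- The hyperbolic translation of the unit disc towards `1` with parameter `a`. -/
def translate (a : ℝ) (u : ℂ) : ℂ := (u + a) / (1 + a * u)

variable {a : ℝ} {u : ℂ}

/-- This identity is the reason why the translations preserve both the unit disc and the unit
circle. -/
theorem normSq_one_add_sub (a : ℝ) (u : ℂ) :
    Complex.normSq (1 + a * u) - Complex.normSq (u + a) = (1 - a ^ 2) * (1 - Complex.normSq u) := by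
  simp only [Complex.normSq_apply, Complex.add_re, Complex.add_im, Complex.mul_re, Complex.mul_im,
    Complex.ofReal_re, Complex.ofReal_im, Complex.one_re, Complex.one_im]
  ring

theorem one_add_mul_ne_zero (h0 : 0 ≤ a) (h1 : a ≤ 1) (hu : ‖u‖ ≤ 1) (hu' : u ≠ -1) :
    1 + a * u ≠ 0 := by
  intro h
  have e : (a : ℂ) * u = -1 := by linear_combination h
  have en : a * ‖u‖ = 1 := by
    have := congrArg norm e
    rwa [norm_mul, Complex.norm_of_nonneg h0, norm_neg, norm_one] at this
  have ha : a = 1 := by nlinarith [norm_nonneg u]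
  rw [ha] at e
  exact hu' (by simpa using e)

theorem norm_translate_sq (h : 1 + a * u ≠ 0) :
    1 - ‖translate a u‖ ^ 2 = (1 - a ^ 2) * (1 - ‖u‖ ^ 2) / Complex.normSq (1 + a * u) := by
  have hn : Complex.normSq (1 + a * u) ≠ 0 := by rwa [Ne, Complex.normSq_eq_zero]
  rw [translate, ← Complex.normSq_eq_norm_sq, ← Complex.normSq_eq_norm_sq, map_div₀,
    ← normSq_one_add_sub, sub_div, div_self hn]

theorem norm_translate_le (h0 : 0 ≤ a) (h1 : a ≤ 1) (hu : ‖u‖ ≤ 1) (hu' : u ≠ -1) :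
    ‖translate a u‖ ≤ 1 := by
  have h := norm_translate_sq (one_add_mul_ne_zero h0 h1 hu hu')
  have : 0 ≤ (1 - a ^ 2) * (1 - ‖u‖ ^ 2) / Complex.normSq (1 + a * u) :=
    div_nonneg (mul_nonneg (by nlinarith) (by nlinarith [norm_nonneg u])) (Complex.normSq_nonneg _)
  rw [← sq_le_one_iff₀ (norm_nonneg _)]
  linarith

theorem norm_translate_eq (h0 : 0 ≤ a) (h1 : a ≤ 1) (hu : ‖u‖ = 1) (hu' : u ≠ -1) :
    ‖translate a u‖ = 1 := by
  have h := norm_translate_sq (one_add_mul_ne_zero h0 h1 hu.le hu')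
  rw [hu, one_pow, sub_self, mul_zero, zero_div] at h
  rw [← pow_eq_one_iff_of_nonneg (norm_nonneg _) two_ne_zero]
  linarith

theorem norm_translate_lt (h0 : 0 ≤ a) (h1 : a < 1) (hu : ‖u‖ < 1) :
    ‖translate a u‖ < 1 := by
  have hu' : u ≠ -1 := fun h ↦ by simp [h] at hu
  have hn := one_add_mul_ne_zero h0 h1.le hu.le hu'
  have h := norm_translate_sq hn
  have : 0 < (1 - a ^ 2) * (1 - ‖u‖ ^ 2) / Complex.normSq (1 + a * u) :=
    div_pos (mul_pos (by nlinarith) (by nlinarith [norm_nonneg u])) (Complex.normSq_pos.2 hn)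
  rw [← sq_lt_one_iff₀ (norm_nonneg _)]
  linarith

theorem translate_zero (u : ℂ) : translate 0 u = u := by simp [translate]

theorem translate_one (hu' : u ≠ -1) : translate 1 u = 1 := by
  have : 1 + u ≠ 0 := fun h ↦ hu' (by linear_combination h)
  rw [translate, Complex.ofReal_one, one_mul, add_comm, div_self this]

theorem translate_ne_neg_one (h0 : 0 ≤ a) (h1 : a ≤ 1) (hu : ‖u‖ ≤ 1) (hu' : u ≠ -1) :
    translate a u ≠ -1 := by
  intro h
  rw [translate, div_eq_iff (one_add_mul_ne_zero h0 h1 hu hu')] at h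
  have h2 : ((1 + a : ℝ) : ℂ) * (u + 1) = 0 := by
    push_cast
    linear_combination h
  rcases mul_eq_zero.1 h2 with h3 | h3
  · have : 1 + a = 0 := by exact_mod_cast h3
    linarith
  · exact hu' (by linear_combination h3)

theorem re_translate_pos (h0 : 0 ≤ a) (h1 : a ≤ 1) (hu : ‖u‖ ≤ 1) (hr : 0 < u.re) :
    0 < (translate a u).re := by
  have hu' : u ≠ -1 := fun h ↦ by
    rw [h] at hr
    norm_num at hr
  have hn := Complex.normSq_pos.2 (one_add_mul_ne_zero h0 h1 hu hu')
  rw [translate, Complex.div_re, ← add_div]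
  refine div_pos ?_ hn
  simp only [Complex.add_re, Complex.add_im, Complex.mul_re, Complex.mul_im,
    Complex.ofReal_re, Complex.ofReal_im, Complex.one_re, Complex.one_im]
  nlinarith [mul_nonneg h0 (sq_nonneg u.re), mul_nonneg h0 (sq_nonneg u.im),
    mul_nonneg (sq_nonneg a) hr.le]

/-- Interior points stay interior for `a < 1`; at `a = 1` they jump to the boundary point `1`, which
the half plane contains. -/
theorem translate_lt_or_pos (h0 : 0 ≤ a) (h1 : a ≤ 1) (hu : ‖u‖ ≤ 1)
    (h : ‖u‖ < 1 ∨ 0 < u.re) : ‖translate a u‖ < 1 ∨ 0 < (translate a u).re := by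
  rcases h with h | h
  · rcases h1.lt_or_eq with h1 | rfl
    · exact Or.inl (norm_translate_lt h0 h1 h)
    · right
      rw [translate_one fun h' ↦ by simp [h'] at h]
      simp
  · exact Or.inr (re_translate_pos h0 h1 hu h)

/-- The hyperbolic translation of the unit disc towards `c`. -/
def slide (c : ℂ) (a : ℝ) (z : ℂ) : ℂ := c * translate a (conj c * z)

theorem conj_mul_slide {c : ℂ} (hc : ‖c‖ = 1) (a : ℝ) (z : ℂ) :
    conj c * slide c a z = translate a (conj c * z) := by
  rw [slide, ← mul_assoc, Complex.conj_mul', hc]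
  simp

theorem norm_conj_mul {c : ℂ} (hc : ‖c‖ = 1) (z : ℂ) : ‖conj c * z‖ = ‖z‖ := by simp [hc]

theorem norm_slide {c : ℂ} (hc : ‖c‖ = 1) (a : ℝ) (z : ℂ) :
    ‖slide c a z‖ = ‖translate a (conj c * z)‖ := by
  rw [slide, norm_mul, hc, one_mul]

theorem conj_mul_ne_neg_one {c : ℂ} (hc : ‖c‖ = 1) {z : ℂ} (hz : z ≠ -c) :
    conj c * z ≠ -1 := by
  intro h
  have h1 : c * conj c = 1 := by rw [Complex.mul_conj', hc]; simp
  refine hz ?_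
  linear_combination c * h - z * h1

/-- `V` is contracted to `c` within `V` by the hyperbolic translations towards `c`. -/
structure SlidesTo (V : Set ℂ) (c : ℂ) : Prop where
  norm_eq : ‖c‖ = 1
  mem : c ∈ V
  ne_neg : ∀ z ∈ V, ‖z‖ ≤ 1 → z ≠ -c
  slide_mem : ∀ z ∈ V, ‖z‖ ≤ 1 → ∀ a : ℝ, 0 ≤ a → a ≤ 1 → slide c a z ∈ V

theorem slidesTo_compl {c : ℂ} (hc : ‖c‖ = 1) : SlidesTo {z | z ≠ -c} c where
  norm_eq := hc
  mem h := by
    have : c = 0 := by linear_combination h / 2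
    simp [this] at hc
  ne_neg z hz _ := hz
  slide_mem z hz hz1 a h0 h1 h := by
    refine translate_ne_neg_one h0 h1 ((norm_conj_mul hc z).trans_le hz1)
      (conj_mul_ne_neg_one hc hz) ?_
    rw [← conj_mul_slide hc, h, mul_neg, Complex.conj_mul', hc]
    simp

/-- The union of the open disc and the open half plane centered at `c`. -/
def capped (c : ℂ) : Set ℂ := {z | ‖z‖ < 1 ∨ 0 < (conj c * z).re}

theorem isOpen_capped (c : ℂ) : IsOpen (capped c) :=
  IsOpen.union (s₁ := {z | ‖z‖ < 1}) (s₂ := {z | 0 < (conj c * z).re})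
    (isOpen_lt (by fun_prop) (by fun_prop)) (isOpen_lt (by fun_prop) (by fun_prop))

/-- For purely imaginary `c` the points `±1` lie on the unit circle and on the edge of the half
plane, so the cap already avoids them. -/
theorem slidesTo_capped {c : ℂ} (hc : ‖c‖ = 1) (hre : c.re = 0) :
    SlidesTo ({z | z ≠ -1} ∩ {z | z ≠ 1} ∩ capped c) c := by
  have hne : ∀ z ∈ capped c, z ≠ -1 ∧ z ≠ 1 := by
    rintro z hz
    constructor <;> rintro rfl <;> simp [capped, hre] at hz
  refine ⟨hc, ?_, fun z hz _ h ↦ ?_, fun z hz hz1 a h0 h1 ↦ ?_⟩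
  · have : c ∈ capped c := Or.inr (by rw [Complex.conj_mul', hc]; simp)
    exact ⟨hne c this, this⟩
  · rcases hz.2 with h' | h'
    · rw [h, norm_neg, hc] at h'
      exact lt_irrefl _ h'
    · rw [h, mul_neg, Complex.conj_mul', hc] at h'
      norm_num at h'
  · have : slide c a z ∈ capped c := by
      rw [capped, Set.mem_ofPred_eq, norm_slide hc, conj_mul_slide hc]
      refine translate_lt_or_pos h0 h1 ((norm_conj_mul hc z).trans_le hz1) ?_
      rw [norm_conj_mul hc]
      exact hz.2
    exact ⟨hne _ this, this⟩

end Translation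

/-! ### Shrinking one coordinate of the moment-angle complex -/

section Shrink

open scoped ComplexConjugate

variable {m : ℕ} {K : PreAbstractSimplicialComplex (Fin m)}

theorem mem_momentAngleComplex_iff {z : Fin m → ℂ} :
    z ∈ momentAngleComplex K ↔
      ∃ ω, IsSimplex K ω ∧ (∀ i, ‖z i‖ ≤ 1) ∧ ∀ i, i ∉ ω → ‖z i‖ = 1 := by
  simp only [momentAngleComplex, kPower, Set.mem_iUnion, Set.mem_ofPred_eq, exists_prop,
    mem_closedBall_zero_iff, mem_sphere_zero_iff_norm]

theorem update_mem_momentAngleComplex {z : Fin m → ℂ} (hz : z ∈ momentAngleComplex K) (i : Fin m)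
    {w : ℂ} (hw : ‖w‖ ≤ 1) (hw' : ‖z i‖ = 1 → ‖w‖ = 1) :
    Function.update z i w ∈ momentAngleComplex K := by
  obtain ⟨ω, hω, h1, h2⟩ := mem_momentAngleComplex_iff.1 hz
  refine mem_momentAngleComplex_iff.2 ⟨ω, hω, fun j ↦ ?_, fun j hj ↦ ?_⟩
  · by_cases h : j = i
    · subst h; simpa using hw
    · simpa [h] using h1 j
  · by_cases h : j = i
    · subst h; simpa using hw' (h2 j hj)
    · simpa [h] using h2 j hj

variable (K) in
/-- The part of the moment-angle complex with coordinates in given sets. -/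
def boxed (W : Fin m → Set ℂ) : Set (Fin m → ℂ) := {z | z ∈ momentAngleComplex K ∧ ∀ j, z j ∈ W j}

/-- The map that sets the `i`-th coordinate to `c`. -/
def setCoord (i : Fin m) (c : ℂ) : C(Fin m → ℂ, Fin m → ℂ) :=
  ⟨fun z ↦ Function.update z i c, continuous_id.update i continuous_const⟩

theorem setCoord_mem_boxed {W : Fin m → Set ℂ} {i : Fin m} {c : ℂ} (hc : ‖c‖ = 1) (hcW : c ∈ W i)
    {z : Fin m → ℂ} (hz : z ∈ boxed K W) : setCoord i c z ∈ boxed K W := by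
  refine ⟨update_mem_momentAngleComplex hz.1 i hc.le fun _ ↦ hc, fun j ↦ ?_⟩
  change Function.update z i c j ∈ W j
  by_cases h : j = i
  · subst h; simpa using hcW
  · simpa [h] using hz.2 j

/-- The homotopy from the identity to `setCoord i c` slides the `i`-th coordinate. It stays in `Z_K`
because points of the circle remain on the circle; interior points may end on the circle, which is
always allowed. -/
theorem push_setCoord_sub_mem {W : Fin m → Set ℂ} {O : Set ℂ} {i : Fin m} {c : ℂ}
    (h : SlidesTo (W i ∩ O) c) {x : SChain (Fin m → ℂ)}
    (hx : x ∈ sub (boxed K W ∩ {z | z i ∈ O})) (hd : bd _ x = 0) :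
    push (setCoord i c) x - x ∈ (sub (boxed K W ∩ {z | z i ∈ O})).map (bd _) := by
  have hle : ∀ z ∈ boxed K W, ‖z i‖ ≤ 1 := fun z hz ↦ by
    obtain ⟨ω, -, h1, -⟩ := mem_momentAngleComplex_iff.1 hz.1
    exact h1 i
  have hne : ∀ z ∈ boxed K W ∩ {z | z i ∈ O}, conj c * z i ≠ -1 := fun z hz ↦
    conj_mul_ne_neg_one h.norm_eq (h.ne_neg _ ⟨hz.1.2 i, hz.2⟩ (hle z hz.1))
  have hnorm : ∀ z ∈ boxed K W, ‖conj c * z i‖ ≤ 1 := fun z hz ↦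
    (norm_conj_mul h.norm_eq _).trans_le (hle z hz)
  refine push_sub_mem_map_bd (H := fun q ↦ Function.update q.1 i (slide c (q.2 1) (q.1 i)))
    ?_ ?_ ?_ ?_ hx hd
  · refine continuousOn_pi.2 fun j ↦ ?_
    by_cases hj : j = i
    · subst hj
      simp only [Function.update_self, slide, translate]
      have ha : Continuous fun q : (Fin m → ℂ) × Interval ↦ ((q.2 1 : ℝ) : ℂ) :=
        Complex.continuous_ofReal.comp
          ((continuous_apply (1 : Fin 2)).comp (continuous_subtype_val.comp continuous_snd))
      refine ContinuousOn.mul continuousOn_const (ContinuousOn.div ?_ ?_ ?_)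
      · exact Continuous.continuousOn (by fun_prop)
      · exact Continuous.continuousOn (by fun_prop)
      · rintro ⟨z, s⟩ ⟨hz, -⟩
        exact one_add_mul_ne_zero (stdSimplex.zero_le s 1) (stdSimplex.le_one s 1) (hnorm z hz.1)
          (hne z hz)
    · simp only [Function.update_of_ne hj]
      exact Continuous.continuousOn (by fun_prop)
  · intro z hz s
    have h0 := stdSimplex.zero_le s 1
    have h1 := stdSimplex.le_one s 1
    have hs := h.slide_mem _ ⟨hz.1.2 i, hz.2⟩ (hle z hz.1) _ h0 h1
    refine ⟨⟨update_mem_momentAngleComplex hz.1.1 i ?_ fun h' ↦ ?_, fun j ↦ ?_⟩, ?_⟩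
    · rw [norm_slide h.norm_eq]
      exact norm_translate_le h0 h1 (hnorm z hz.1) (hne z hz)
    · rw [norm_slide h.norm_eq]
      exact norm_translate_eq h0 h1 ((norm_conj_mul h.norm_eq _).trans h') (hne z hz)
    · by_cases hj : j = i
      · subst hj
        simpa using hs.1
      · simpa [hj] using hz.1.2 j
    · simpa using hs.2
  · intro z hz
    simp only [slide, stdSimplex.vertex_coe]
    rw [Pi.single_eq_of_ne (by decide), translate_zero, ← mul_assoc, Complex.mul_conj', h.norm_eq]
    simp
  · intro z hz
    simp only [slide, stdSimplex.vertex_coe]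
    rw [Pi.single_eq_same, translate_one (hne z hz), mul_one]
    rfl

/-- The total homology rank of a subspace. -/
abbrev subRank {E : Type} [TopologicalSpace E] (P : Set E) : Cardinal :=
  Module.rank ℚ (SubHomology (bd E) (sub P))

/-- The geometric core: the Mayer–Vietoris inequality applies because `c` and `c'` have norm one, so
`setCoord` maps the whole of `boxed K W` into either piece, whether or not `i` is a vertex of the
relevant simplex. -/
theorem subRank_boxed_update_le {W : Fin m → Set ℂ} {O O' : Set ℂ} {i : Fin m} {c c' : ℂ}
    (hO : IsOpen O) (hO' : IsOpen O') (hW : ∀ z ∈ W i, ‖z‖ ≤ 1 → z ∈ O ∪ O')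
    (h : SlidesTo (W i ∩ O) c) (h' : SlidesTo (W i ∩ O') c') :
    subRank (boxed K (Function.update W i (W i ∩ O ∩ O'))) ≤ subRank (boxed K W) := by
  have he : boxed K (Function.update W i (W i ∩ O ∩ O')) =
      (boxed K W ∩ {z | z i ∈ O}) ∩ (boxed K W ∩ {z | z i ∈ O'}) := by
    ext z
    constructor
    · rintro ⟨hz, hW⟩
      have hi := hW i
      rw [Function.update_self] at hi
      have : z ∈ boxed K W := ⟨hz, fun j ↦ by
        by_cases hj : j = i
        · subst hj; exact hi.1.1
        · simpa [hj] using hW j⟩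
      exact ⟨⟨this, hi.1.2⟩, this, hi.2⟩
    · rintro ⟨⟨hz, hzO⟩, -, hzO'⟩
      refine ⟨hz.1, fun j ↦ ?_⟩
      by_cases hj : j = i
      · subst hj
        rw [Function.update_self]
        exact ⟨⟨hz.2 j, hzO⟩, hzO'⟩
      · simpa [hj] using hz.2 j
  rw [subRank, he, sub_inter]
  refine rank_subHomology_inf_le bd_bd (sub_mono Set.inter_subset_left)
    (sub_mono Set.inter_subset_left) (fun _ ↦ bd_mem_sub) (fun _ ↦ bd_mem_sub) ?_
    (p := push (setCoord i c)) (q := push (setCoord i c')) (push_bd _) (push_bd _) ?_ ?_ ?_ ?_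
  · intro w hw hdw
    refine exists_bd_eq_of_small (hO.preimage (continuous_apply i))
      (hO'.preimage (continuous_apply i)) (fun z hz ↦ ?_) hw hdw
    obtain ⟨ω, -, h1, -⟩ := mem_momentAngleComplex_iff.1 hz.1
    exact hW _ (hz.2 i) (h1 i)
  · refine fun x ↦ push_mem_sub fun z hz ↦
      Set.mem_inter (setCoord_mem_boxed h.norm_eq h.mem.1 hz) ?_
    simpa [setCoord] using h.mem.2
  · refine fun x ↦ push_mem_sub fun z hz ↦
      Set.mem_inter (setCoord_mem_boxed h'.norm_eq h'.mem.1 hz) ?_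
    simpa [setCoord] using h'.mem.2
  · exact fun x ↦ push_setCoord_sub_mem h
  · exact fun x ↦ push_setCoord_sub_mem h'

/-! ### Cutting down to a region with separated signs. -/

/-- The plane without the points `1` and `-1`. -/
def poleless : Set ℂ := {z | z ≠ -1} ∩ {z | z ≠ 1}

theorem subRank_boxed_update_poleless_le {W : Fin m → Set ℂ} {i : Fin m} (hi : W i = Set.univ) :
    subRank (boxed K (Function.update W i poleless)) ≤ subRank (boxed K W) := by
  have := subRank_boxed_update_le (K := K) (W := W) (i := i) (O := {z | z ≠ -1}) (O' := {z | z ≠ 1})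
    (c := 1) (c' := -1) isOpen_ne isOpen_ne (fun z _ _ ↦ ?_)
    (by rw [hi, Set.univ_inter]; exact slidesTo_compl (by simp))
    (by rw [hi, Set.univ_inter]; simpa using slidesTo_compl (c := -1) (by simp))
  · rwa [hi, Set.univ_inter] at this
  · by_cases h : z = -1
    · right
      rintro rfl
      norm_num at h
    · exact Or.inl h

theorem subRank_boxed_update_capped_le {W : Fin m → Set ℂ} {i : Fin m} (hi : W i = Set.univ) :
    subRank (boxed K (Function.update W i (poleless ∩ capped Complex.I ∩ capped (-Complex.I)))) ≤
      subRank (boxed K W) := by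
  -- The poles must be removed first: the two caps cover the closed disc except for `±1`.
  refine le_trans ?_ (subRank_boxed_update_poleless_le hi)
  have := subRank_boxed_update_le (K := K) (W := Function.update W i poleless) (i := i)
    (O := capped Complex.I) (O' := capped (-Complex.I)) (c := Complex.I) (c' := -Complex.I)
    (isOpen_capped _) (isOpen_capped _) ?_
    (by rw [Function.update_self]; exact slidesTo_capped (by simp) (by simp))
    (by rw [Function.update_self]; exact slidesTo_capped (by simp) (by simp))
  · rwa [Function.update_self, Function.update_idem] at this
  · intro z hz hz1
    rw [Function.update_self] at hz
    rcases hz1.lt_or_eq with h | h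
    · exact Or.inl (Or.inl h)
    · rcases lt_trichotomy z.im 0 with h0 | h0 | h0
      · exact Or.inr (Or.inr (by simpa using h0))
      · exfalso
        have hr : z.re ^ 2 = 1 := by
          have := Complex.normSq_eq_norm_sq z
          rw [h, Complex.normSq_apply, h0] at this
          linarith
        rcases sq_eq_sq_iff_eq_or_eq_neg.1 (hr.trans (one_pow 2).symm) with h2 | h2
        · exact hz.2 (Complex.ext h2 h0)
        · exact hz.1 (Complex.ext (by simpa using h2) (by simpa using h0))
      · exact Or.inl (Or.inr (by simpa using h0))

/-- The sets that the coordinates are restricted to: the open disc for the vertices of `ω`,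
and the complement of the poles otherwise. -/
def target (ω : Finset (Fin m)) (j : Fin m) : Set ℂ :=
  if j ∈ ω then poleless ∩ capped Complex.I ∩ capped (-Complex.I) else poleless

theorem subRank_boxed_target_le (ω : Finset (Fin m)) :
    subRank (boxed K (target ω)) ≤ subRank (momentAngleComplex K) := by
  have key : ∀ s : Finset (Fin m),
      subRank (boxed K fun j ↦ if j ∈ s then target ω j else Set.univ) ≤
        subRank (momentAngleComplex K) := by
    intro s
    induction s using Finset.induction_on with
    | empty =>
      apply le_of_eq
      congr 2
      ext z
      simp [boxed]
    | insert i s hi ih =>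
      refine le_trans ?_ ih
      have he : (fun j ↦ if j ∈ insert i s then target ω j else Set.univ) =
          Function.update (fun j ↦ if j ∈ s then target ω j else Set.univ) i (target ω i) := by
        ext1 j
        by_cases hj : j = i
        · subst hj; simp
        · simp [hj]
      rw [he]
      by_cases h : i ∈ ω
      · rw [target, if_pos h]
        exact subRank_boxed_update_capped_le (by simp [hi])
      · rw [target, if_neg h]
        exact subRank_boxed_update_poleless_le (by simp [hi])
  simpa using key Finset.univ

/-- The half planes of the two caps are disjoint, so only the open disc survives in their
intersection. -/
theorem norm_lt_one_of_mem_target {ω : Finset (Fin m)} {j : Fin m} (hj : j ∈ ω) {z : ℂ}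
    (hz : z ∈ target ω j) : ‖z‖ < 1 := by
  rw [target, if_pos hj] at hz
  rcases hz.1.2 with h | h
  · exact h
  rcases hz.2 with h' | h'
  · exact h'
  simp at h h'
  linarith

/-- The only use of maximality: a simplex witnessing `z ∈ Z_K` contains every interior coordinate,
hence contains `ω`, hence equals `ω`. So `z j` lies on the circle, where `±1` are the only real
points. -/
theorem im_ne_zero_of_mem_boxed_target {ω : Finset (Fin m)} (hω : Maximal (IsSimplex K) ω)
    {z : Fin m → ℂ} (hz : z ∈ boxed K (target ω)) {j : Fin m} (hj : j ∉ ω) : (z j).im ≠ 0 := by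
  obtain ⟨τ, hτ, -, h2⟩ := mem_momentAngleComplex_iff.1 hz.1
  have hωτ : ω ≤ τ := fun i hi ↦ by
    by_contra h
    have := norm_lt_one_of_mem_target hi (hz.2 i)
    rw [h2 i h] at this
    exact lt_irrefl _ this
  have h1 : ‖z j‖ = 1 := h2 j fun h ↦ hj (hω.2 hτ hωτ h)
  intro h0
  have hr : (z j).re ^ 2 = 1 := by
    have := Complex.normSq_eq_norm_sq (z j)
    rw [h1, Complex.normSq_apply, h0] at this
    linarith
  have hp := hz.2 j
  rw [target, if_neg hj] at hp
  rcases sq_eq_sq_iff_eq_or_eq_neg.1 (hr.trans (one_pow 2).symm) with h2 | h2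
  · exact hp.2 (Complex.ext h2 h0)
  · exact hp.1 (Complex.ext (by simpa using h2) (by simpa using h0))

/-- The signs of the imaginary parts of the coordinates outside `ω`. -/
def signs (ω : Finset (Fin m)) (z : Fin m → ℂ) (j : {j // j ∉ ω}) : Bool := decide (0 < (z j).im)

/-- The functional on chains that counts the points with given signs of imaginary parts. -/
def signFunctional (ω : Finset (Fin m)) (ε : {j // j ∉ ω} → Bool) :
    SChain (Fin m → ℂ) →ₗ[ℚ] ℚ :=
  chainLift fun n σ ↦
    if n = 0 then (Pi.single ε 1 : ({j // j ∉ ω} → Bool) → ℚ) (signs ω (σ (stdSimplex.vertex 0)))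
    else 0

/-- By the intermediate value theorem the signs are constant along an edge, so its two endpoints
cancel. Boundaries of higher simplices contain no points. -/
theorem signFunctional_bd {ω : Finset (Fin m)} (hω : Maximal (IsSimplex K) ω)
    (ε : {j // j ∉ ω} → Bool) {x : SChain (Fin m → ℂ)} (hx : x ∈ sub (boxed K (target ω))) :
    signFunctional ω ε (bd _ x) = 0 := by
  refine eqOn_sub (f := signFunctional ω ε ∘ₗ bd _) (g := 0) (fun n σ hσ ↦ ?_) hx
  rw [LinearMap.comp_apply, LinearMap.zero_apply]
  match n with
  | 0 => rw [bd_zero, map_zero]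
  | 1 =>
    have hs : ∀ (j : {j // j ∉ ω}) (s t : stdSimplex ℝ (Fin (1 + 1))),
        0 < (σ s j).im → 0 < (σ t j).im := by
      intro j s t h
      by_contra h'
      have hpc : PathConnectedSpace (stdSimplex ℝ (Fin (1 + 1))) :=
        isPathConnected_iff_pathConnectedSpace.1 (isPathConnected_stdSimplex _)
      obtain ⟨r, hr⟩ := mem_range_of_exists_le_of_exists_ge (f := fun t ↦ (σ t j).im) (c := 0)
        (by fun_prop) ⟨t, not_lt.1 h'⟩ ⟨s, h.le⟩
      exact im_ne_zero_of_mem_boxed_target hω (hσ r) j.2 hr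
    have he : ∀ s t : stdSimplex ℝ (Fin (1 + 1)),
        signs ω (σ s) = signs ω (σ t) := by
      intro s t
      ext1 j
      exact decide_eq_decide.2 ⟨hs j s t, hs j t s⟩
    rw [bd_succ, Fin.sum_univ_two, map_add, map_smul, map_smul, signFunctional, chainLift_ssx,
      chainLift_ssx]
    simp only [ContinuousMap.comp_apply]
    rw [he (face 0 (stdSimplex.vertex 0)) (face 1 (stdSimplex.vertex 0))]
    simp
  | n + 2 =>
    rw [bd_succ, map_sum]
    refine Finset.sum_eq_zero fun i _ ↦ ?_
    rw [map_smul, signFunctional, chainLift_ssx, if_neg (by omega), smul_zero]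

/-- The point with coordinates `0` in `ω` and `± i` elsewhere. -/
def signPoint (ω : Finset (Fin m)) (ε : {j // j ∉ ω} → Bool) (j : Fin m) : ℂ :=
  if h : j ∈ ω then 0 else if ε ⟨j, h⟩ then Complex.I else -Complex.I

theorem signPoint_mem {ω : Finset (Fin m)} (hω : IsSimplex K ω) (ε : {j // j ∉ ω} → Bool) :
    signPoint ω ε ∈ boxed K (target ω) := by
  refine ⟨mem_momentAngleComplex_iff.2 ⟨ω, hω, fun i ↦ ?_, fun i hi ↦ ?_⟩, fun i ↦ ?_⟩
  · rw [signPoint]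
    split_ifs <;> simp
  · rw [signPoint, dif_neg hi]
    split_ifs <;> simp
  · rw [signPoint, target]
    split_ifs with h
    · simp [poleless, capped]
    · simp [poleless, Complex.ext_iff]
    · simp [poleless, Complex.ext_iff]

/-- Each of the `2 ^ (m - |ω|)` sign patterns is realized by a `signPoint`, and the functionals
`signFunctional` are dual to these points. -/
theorem two_pow_le_subRank {ω : Finset (Fin m)} (hω : Maximal (IsSimplex K) ω) :
    ((2 ^ (m - ω.card) : ℕ) : Cardinal) ≤ subRank (momentAngleComplex K) := by
  classical
  refine le_trans ?_ (subRank_boxed_target_le ω)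
  have hcard : Fintype.card ({j // j ∉ ω} → Bool) = 2 ^ (m - ω.card) := by
    rw [Fintype.card_fun, Fintype.card_bool]
    congr 1
    simp [Fintype.card_subtype_compl]
  rw [← hcard]
  refine card_le_rank_subHomology
    (fun ε ↦ ssx (n := 0) (ContinuousMap.const _ (signPoint ω ε)))
    (fun ε ↦ ⟨bd_zero _, ssx_mem_sub fun _ ↦ signPoint_mem hω.1 ε⟩) (signFunctional ω)
    (fun ε x ↦ signFunctional_bd hω ε) fun ε ε' ↦ ?_
  rw [signFunctional, chainLift_ssx, if_pos rfl]
  have : signs ω (signPoint ω ε') = ε' := by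
    ext1 j
    rw [signs, signPoint, dif_neg j.2]
    cases h : ε' j <;> simp
  simp only [ContinuousMap.const_apply]
  rw [this, Pi.single_apply]
  simp only [eq_comm]

end Shrink

/-! ### Comparison with singular cohomology -/

section Comparison

open scoped Simplicial

theorem push_injective {E E' : Type} [TopologicalSpace E] [TopologicalSpace E'] {f : C(E, E')}
    (hf : Function.Injective f) : Function.Injective (push f) := by
  have h : push f = Finsupp.lmapDomain ℚ ℚ
      (fun p : SSimplex E ↦ (⟨p.1, f.comp p.2⟩ : SSimplex E')) := by
    refine ssx_hom_ext fun n σ ↦ ?_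
    rw [push_ssx, Finsupp.lmapDomain_apply, Finsupp.mapDomain_single]
  rw [h]
  refine Finsupp.mapDomain_injective ?_
  rintro ⟨n, σ⟩ ⟨n', σ'⟩ h
  obtain ⟨rfl, h⟩ := Sigma.mk.inj h
  exact congrArg (Sigma.mk n) ((ContinuousMap.cancel_left hf).1 (eq_of_heq h))

/-- The rank of a subspace can be computed intrinsically. -/
theorem subRank_le_subRank_univ {E : Type} [TopologicalSpace E] (P : Set E) :
    subRank P ≤ subRank (Set.univ : Set P) := by
  let ι : C(P, E) := ⟨Subtype.val, continuous_subtype_val⟩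
  refine rank_subHomology_le_of_reflect (push ι) (push_injective Subtype.val_injective)
    (push_bd ι) (le_antisymm ?_ ?_)
  · rintro _ ⟨x, hx, rfl⟩
    exact push_mem_sub (fun x _ ↦ x.2) hx
  · rw [sub_eq_span, Submodule.span_le]
    rintro _ ⟨⟨n, σ⟩, hσ, rfl⟩
    let τ : C(stdSimplex ℝ (Fin (n + 1)), P) := ⟨fun t ↦ ⟨σ t, hσ t⟩, by fun_prop⟩
    exact ⟨ssx τ, ssx_mem_sub fun _ ↦ trivial, push_ssx ι τ⟩

variable {X : Type} [TopologicalSpace X]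

variable (X) in
/-- The singular simplicial set. -/
abbrev singularSet : SSet.{0} := TopCat.toSSet.obj (TopCat.of X)

variable (X) in
/-- The rational singular chain complex. -/
abbrev singularComplex : ChainComplex (ModuleCat.{0} ℚ) ℕ :=
  (singularSet X).chainComplex (ModuleCat.of ℚ ℚ)

/-- The simplices of the singular simplicial set are the singular simplices. -/
abbrev simplexEquiv (n : ℕ) : (singularSet X) _⦋n⦌ ≃ C(stdSimplex ℝ (Fin (n + 1)), X) :=
  TopCat.toSSetObjEquiv (TopCat.of X) (.op ⦋n⦌)

theorem simplexEquiv_δ {n : ℕ} (x : (singularSet X) _⦋n + 1⦌) (i : Fin (n + 2)) :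
    simplexEquiv n ((singularSet X).δ i x) = (simplexEquiv (n + 1) x).comp (face i) := by
  ext t
  rw [ContinuousMap.comp_apply, face_eq_map]
  rfl

variable (X) in
/-- Singular cochains. -/
abbrev Cochain (n : ℕ) : Type := (singularComplex X).X n ⟶ ModuleCat.of ℚ ℚ

/-- The generator of the singular chain complex given by a singular simplex. -/
def gen {n : ℕ} (σ : C(stdSimplex ℝ (Fin (n + 1)), X)) : (singularComplex X).X n :=
  ((singularSet X).ιChainComplex (R := ModuleCat.of ℚ ℚ) ((simplexEquiv n).symm σ)).hom (1 : ℚ)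

theorem d_gen {n : ℕ} (σ : C(stdSimplex ℝ (Fin (n + 1 + 1)), X)) :
    ((singularComplex X).d (n + 1) n).hom (gen σ) =
      ∑ i : Fin (n + 2), (-1 : ℚ) ^ (i : ℕ) • gen (σ.comp (face i)) := by
  have h := (singularSet X).ιChainComplex_d (ModuleCat.of ℚ ℚ) ((simplexEquiv (n + 1)).symm σ)
  have h1 := congrArg (fun f ↦ f.hom (1 : ℚ)) h
  refine h1.trans ?_
  rw [ModuleCat.hom_sum, LinearMap.sum_apply]
  refine Finset.sum_congr rfl fun i _ ↦ ?_
  have hi : (simplexEquiv n).symm (σ.comp (face i)) =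
      (singularSet X).δ i ((simplexEquiv (n + 1)).symm σ) := by
    rw [Equiv.symm_apply_eq, simplexEquiv_δ, Equiv.apply_symm_apply]
  rw [gen, hi]
  rcases Nat.even_or_odd (i : ℕ) with h | h <;> simp [h.neg_one_pow]

/-- Evaluation of a family of cochains on chains. -/
def evalFamily (f : ∀ n, Cochain X n) : SChain X →ₗ[ℚ] ℚ :=
  chainLift fun n σ ↦ (f n).hom (gen σ)

theorem evalFamily_ssx (f : ∀ n, Cochain X n) {n : ℕ} (σ : C(stdSimplex ℝ (Fin (n + 1)), X)) :
    evalFamily f (ssx σ) = (f n).hom (gen σ) := by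
  rw [evalFamily, chainLift_ssx]

/-- Evaluation of cochains of a fixed degree on chains. -/
def evalCochain (n : ℕ) : Cochain X n →ₗ[ℚ] SChain X →ₗ[ℚ] ℚ where
  toFun f := evalFamily (Pi.single n f)
  map_add' f g := by
    refine ssx_hom_ext fun k σ ↦ ?_
    rw [LinearMap.add_apply, evalFamily_ssx, evalFamily_ssx, evalFamily_ssx, Pi.single_add,
      Pi.add_apply]
    rfl
  map_smul' c f := by
    refine ssx_hom_ext fun k σ ↦ ?_
    rw [RingHom.id_apply, LinearMap.smul_apply, evalFamily_ssx, evalFamily_ssx, Pi.single_smul,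
      Pi.smul_apply]
    rfl

theorem evalCochain_self {n : ℕ} (f : Cochain X n) (σ : C(stdSimplex ℝ (Fin (n + 1)), X)) :
    evalCochain n f (ssx σ) = f.hom (gen σ) := by
  change evalFamily (Pi.single n f) (ssx σ) = _
  rw [evalFamily_ssx, Pi.single_eq_same]

theorem evalCochain_of_ne {n k : ℕ} (h : k ≠ n) (f : Cochain X n)
    (σ : C(stdSimplex ℝ (Fin (k + 1)), X)) : evalCochain n f (ssx σ) = 0 := by
  change evalFamily (Pi.single n f) (ssx σ) = _
  rw [evalFamily_ssx, Pi.single_eq_of_ne h]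
  rfl

theorem evalCochain_d {n : ℕ} (g : Cochain X n) (x : SChain X) :
    evalCochain (n + 1) ((singularComplex X).d (n + 1) n ≫ g) x = evalCochain n g (bd X x) := by
  suffices h : evalCochain (n + 1) ((singularComplex X).d (n + 1) n ≫ g) =
      evalCochain n g ∘ₗ bd X from LinearMap.congr_fun h x
  refine ssx_hom_ext fun k σ ↦ ?_
  rw [LinearMap.comp_apply]
  cases k with
  | zero => rw [bd_zero, map_zero, evalCochain_of_ne (by omega)]
  | succ k =>
    rw [bd_succ, map_sum]
    by_cases h : k = n
    · subst h
      rw [evalCochain_self, ModuleCat.hom_comp, LinearMap.comp_apply, d_gen, map_sum]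
      refine Finset.sum_congr rfl fun i _ ↦ ?_
      rw [map_smul, map_smul, evalCochain_self]
    · rw [evalCochain_of_ne (by omega)]
      refine (Finset.sum_eq_zero fun i _ ↦ ?_).symm
      rw [map_smul, evalCochain_of_ne h, smul_zero]

/-- The cochain with given values on simplices. -/
def mkCochain (l : SChain X →ₗ[ℚ] ℚ) (n : ℕ) : Cochain X n :=
  ((singularSet X).isColimitChainComplexXCofan (ModuleCat.of ℚ ℚ) n).desc
    (Limits.Cofan.mk (ModuleCat.of ℚ ℚ) fun x ↦
      ModuleCat.ofHom (LinearMap.toSpanSingleton ℚ ℚ (l (ssx (simplexEquiv n x)))))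

theorem mkCochain_gen (l : SChain X →ₗ[ℚ] ℚ) {n : ℕ} (σ : C(stdSimplex ℝ (Fin (n + 1)), X)) :
    (mkCochain l n).hom (gen σ) = l (ssx σ) := by
  have h := ((singularSet X).isColimitChainComplexXCofan (ModuleCat.of ℚ ℚ) n).fac
    (Limits.Cofan.mk (ModuleCat.of ℚ ℚ) fun x ↦
      ModuleCat.ofHom (LinearMap.toSpanSingleton ℚ ℚ (l (ssx (simplexEquiv n x)))))
    ⟨(simplexEquiv n).symm σ⟩
  have h1 := congrArg (fun f ↦ f.hom (1 : ℚ)) h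
  refine h1.trans ?_
  change (1 : ℚ) • l (ssx (simplexEquiv n ((simplexEquiv n).symm σ))) = _
  rw [one_smul, Equiv.apply_symm_apply]

theorem cochain_ext {n : ℕ} {f g : Cochain X n}
    (h : ∀ σ : C(stdSimplex ℝ (Fin (n + 1)), X), f.hom (gen σ) = g.hom (gen σ)) : f = g := by
  refine SSet.chainComplex_hom_ext fun x ↦ ModuleCat.hom_ext (LinearMap.ext_ring ?_)
  have := h (simplexEquiv n x)
  rw [gen, Equiv.symm_apply_apply] at this
  exact this

theorem d_mkCochain {l : SChain X →ₗ[ℚ] ℚ} (hl : ∀ x, l (bd X x) = 0) (n : ℕ) :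
    (singularComplex X).d (n + 1) n ≫ mkCochain l n = 0 := by
  refine cochain_ext fun σ ↦ ?_
  rw [ModuleCat.hom_comp, LinearMap.comp_apply, d_gen, map_sum]
  have h := hl (ssx σ)
  rw [bd_succ, map_sum] at h
  refine Eq.trans (Finset.sum_congr rfl fun i _ ↦ ?_) h
  rw [map_smul, map_smul, mkCochain_gen]

variable (X) in
/-- The short complex that computes singular cohomology. -/
abbrev cohSc (n : ℕ) : ShortComplex (ModuleCat.{0} ℚ) :=
  ((singularComplex X).linearYonedaObj ℚ (ModuleCat.of ℚ ℚ)).sc n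

variable (X) in
/-- Cocycles modulo coboundaries. -/
abbrev CohQuot (n : ℕ) : Type :=
  LinearMap.ker (cohSc X n).g.hom ⧸ LinearMap.range (cohSc X n).moduleCatToCycles

theorem rank_cohQuot (n : ℕ) :
    Module.rank ℚ (CohQuot X n) = Module.rank ℚ (singularCohomology X n) :=
  (cohSc X n).moduleCatHomologyIso.toLinearEquiv.rank_eq.symm

theorem mem_ker_g {n : ℕ} {f : Cochain X n} (h : (singularComplex X).d (n + 1) n ≫ f = 0) :
    f ∈ LinearMap.ker (cohSc X n).g.hom := by
  have hn : (ComplexShape.up ℕ).next n = n + 1 := CochainComplex.next ℕ n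
  change (singularComplex X).d ((ComplexShape.up ℕ).next n) n ≫ f = 0
  rw [hn, h]

theorem evalCochain_f {n : ℕ} (g : (cohSc X n).X₁) {x : SChain X} (hx : bd X x = 0) :
    evalCochain n ((cohSc X n).f.hom g : Cochain X n) x = 0 := by
  change evalCochain n ((singularComplex X).d n ((ComplexShape.up ℕ).prev n) ≫
    (g : Cochain X ((ComplexShape.up ℕ).prev n))) x = 0
  change Cochain X ((ComplexShape.up ℕ).prev n) at g
  cases n with
  | zero =>
    -- No degree precedes `0`, so the incoming differential vanishes by the shape of the complex.
    rw [(singularComplex X).shape _ _ (by simp), Limits.zero_comp, map_zero]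
    rfl
  | succ n =>
    have hn : (ComplexShape.up ℕ).prev (n + 1) = n := by simp
    revert g
    rw [hn]
    intro g
    rw [evalCochain_d, hx, map_zero]

/-! ### Pairing of cycles with cohomology classes. -/

variable (X) in
/-- The pairing of cycles with cohomology classes. -/
def pairing (n : ℕ) : LinearMap.ker (bd X) →ₗ[ℚ] Module.Dual ℚ (CohQuot X n) :=
  LinearMap.flip <| Submodule.liftQ _
    ((evalCochain n : Cochain X n →ₗ[ℚ] SChain X →ₗ[ℚ] ℚ).compl₂ (LinearMap.ker (bd X)).subtype ∘ₗ
      (LinearMap.ker (cohSc X n).g.hom).subtype) <| by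
    rintro _ ⟨g, rfl⟩
    exact LinearMap.ext fun x ↦ evalCochain_f g x.2

/-- Chains of degree less than `M`. -/
def degLT (X : Type) [TopologicalSpace X] (M : ℕ) : Submodule ℚ (SChain X) :=
  Finsupp.supported ℚ ℚ {p | p.1 < M}

theorem evalFamily_eq_sum (f : ∀ n, Cochain X n) {M : ℕ} {x : SChain X} (hx : x ∈ degLT X M) :
    evalFamily f x = ∑ n ∈ Finset.range M, evalCochain n (f n) x := by
  rw [degLT, Finsupp.supported_eq_span_single] at hx
  rw [← LinearMap.sum_apply]
  refine LinearMap.eqOn_span ?_ hx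
  rintro _ ⟨⟨k, σ⟩, hk, rfl⟩
  rw [LinearMap.sum_apply, evalFamily_ssx, Finset.sum_eq_single k, evalCochain_self]
  · exact fun n _ h ↦ evalCochain_of_ne h.symm _ _
  · exact fun h ↦ absurd (Finset.mem_range.2 hk) h

/-- A cycle that pairs trivially with all cohomology classes is a boundary. -/
theorem mem_range_bd_of_pairing_eq_zero {M : ℕ} {x : SChain X} (hx : bd X x = 0)
    (hM : x ∈ degLT X M) (h : ∀ n < M, pairing X n ⟨x, hx⟩ = 0) : x ∈ LinearMap.range (bd X) := by
  by_contra hb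
  -- Over a field some functional kills all boundaries but not `x`. Its components in each degree
  -- are cocycles, and one of them would have to pair nontrivially with `x`.
  obtain ⟨l, hlx, hl⟩ := Submodule.exists_le_ker_of_notMem hb
  have hl' : ∀ y, l (bd X y) = 0 := fun y ↦ hl ⟨y, rfl⟩
  refine hlx ?_
  have he : l = evalFamily (mkCochain l) := ssx_hom_ext fun n σ ↦ by
    rw [evalFamily_ssx, mkCochain_gen]
  rw [he, evalFamily_eq_sum _ hM]
  refine Finset.sum_eq_zero fun n hn ↦ ?_
  exact LinearMap.congr_fun (h n (Finset.mem_range.1 hn))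
    (Submodule.Quotient.mk ⟨mkCochain l n, mem_ker_g (d_mkCochain hl' n)⟩)

theorem exists_mem_degLT {N : ℕ} (F : (Fin N → ℚ) →ₗ[ℚ] SChain X) :
    ∃ M, ∀ c, F c ∈ degLT X M := by
  let e (k : Fin N) : Fin N → ℚ := fun j ↦ if k = j then 1 else 0
  refine ⟨(Finset.univ.sup fun k ↦ (F (e k)).support.sup Sigma.fst) + 1, fun c ↦ ?_⟩
  rw [LinearMap.pi_apply_eq_sum_univ F c]
  refine Submodule.sum_mem _ fun k _ ↦ Submodule.smul_mem _ _ fun p hp ↦ Nat.lt_succ_of_le ?_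
  exact (Finset.le_sup (f := Sigma.fst) hp).trans
    (Finset.le_sup (f := fun k ↦ (F (e k)).support.sup Sigma.fst) (Finset.mem_univ k))

theorem sum_le_hrk (s : Finset ℕ) :
    ∑ n ∈ s, Cardinal.toENat (Module.rank ℚ (singularCohomology X n)) ≤ hrk X :=
  (hasSum_of_isLUB (f := fun n ↦ Cardinal.toENat (Module.rank ℚ (singularCohomology X n))) _
    (isLUB_iSup (f := fun s : Finset ℕ ↦ s.sum _))).summable.sum_le_tsum s fun _ _ ↦ zero_le

/-- Finitely many independent homology classes have representatives in bounded degrees and inject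
into the duals of finitely many cohomology groups. If these groups are finite-dimensional, their
duals have the same dimensions. -/
theorem natCast_le_hrk {N : ℕ} (hN : (N : Cardinal) ≤ subRank (Set.univ : Set X)) :
    (N : ℕ∞) ≤ hrk X := by
  obtain ⟨f, hf⟩ := Module.le_rank_iff_exists_linearMap.1 hN
  obtain ⟨g, hg⟩ := (Submodule.mkQ (((sub (Set.univ : Set X)).map (bd X)).comap
    (LinearMap.ker (bd X) ⊓ sub Set.univ).subtype)).exists_rightInverse_of_surjective
      (Submodule.range_mkQ _)
  obtain ⟨M, hM⟩ := exists_mem_degLT (Submodule.subtype _ ∘ₗ g ∘ₗ f)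
  -- One infinite-dimensional group already makes `hrk X` infinite.
  by_cases hinf : ∃ n ∈ Finset.range M, Cardinal.aleph0 ≤ Module.rank ℚ (singularCohomology X n)
  · obtain ⟨n, -, hn⟩ := hinf
    have h := sum_le_hrk (X := X) {n}
    rw [Finset.sum_singleton, Cardinal.toENat_eq_top.2 hn, top_le_iff] at h
    rw [h]
    exact le_top
  push Not at hinf
  have hfin : ∀ n : Fin M, Module.Finite ℚ (CohQuot X n) := fun n ↦ by
    rw [← Module.rank_lt_aleph0_iff, rank_cohQuot]
    exact hinf n (Finset.mem_range.2 n.2)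
  let Ψ : (Fin N → ℚ) →ₗ[ℚ] ∀ n : Fin M, Module.Dual ℚ (CohQuot X n) :=
    LinearMap.pi (fun n : Fin M ↦ pairing X n) ∘ₗ
      Submodule.inclusion (inf_le_left : LinearMap.ker (bd X) ⊓ sub Set.univ ≤ _) ∘ₗ g ∘ₗ f
  have hΨ : Function.Injective Ψ := by
    rw [← LinearMap.ker_eq_bot, LinearMap.ker_eq_bot']
    intro c hc
    have h1 : (g (f c)).1 ∈ LinearMap.range (bd X) :=
      mem_range_bd_of_pairing_eq_zero (g (f c)).2.1 (hM c) fun n hn ↦ congrFun hc ⟨n, hn⟩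
    have h2 : Submodule.mkQ _ (g (f c)) = 0 := mkQ_subHomology_eq_zero.2 (by
      obtain ⟨y, hy⟩ := h1
      exact ⟨y, by rw [sub_univ]; trivial, hy⟩)
    refine hf ?_
    rw [map_zero, ← h2]
    exact (LinearMap.congr_fun hg (f c)).symm
  have hle := LinearMap.finrank_le_finrank_of_injective hΨ
  rw [Module.finrank_fin_fun, Module.finrank_pi_fintype] at hle
  refine le_trans ?_ (sum_le_hrk (Finset.range M))
  rw [Finset.sum_range]
  have hterm : ∀ n : Fin M, Cardinal.toENat (Module.rank ℚ (singularCohomology X n)) =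
      (Module.finrank ℚ (Module.Dual ℚ (CohQuot X n)) : ℕ) := fun n ↦ by
    rw [← rank_cohQuot, ← Module.finrank_eq_rank, Cardinal.toENat_nat, Subspace.dual_finrank_eq]
  simp only [hterm]
  exact_mod_cast hle

end Comparison

/-! ### Almost free actions of subtori -/

section Subtori

theorem card_circle_torsion (p : ℕ) [NeZero p] : Nat.card {t : Circle // t ^ p = 1} = p := by
  let e : {t : Circle // t ^ p = 1} ≃ rootsOfUnity p Circle :=
    toUnits.toEquiv.subtypeEquiv fun t ↦ by
      rw [mem_rootsOfUnity]
      change t ^ p = 1 ↔ toUnits t ^ p = 1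
      rw [← map_pow, MulEquiv.map_eq_one_iff]
  rw [Nat.card_congr (e.trans (rootsOfUnityCircleEquiv p).toEquiv),
    Complex.card_rootsOfUnity]

variable {m : ℕ} {K : PreAbstractSimplicialComplex (Fin m)}

/-- The rank of an almost freely acting subtorus is at most the number of vertices outside a given
simplex. -/
theorem rank_le_of_isAlmostFree {ω : Finset (Fin m)} (hω : IsSimplex K ω) {r : ℕ}
    {H : Subgroup (Fin m → Circle)} (hH : IsSubtorus H r)
    (hf : IsAlmostFree H (momentAngleComplex K)) : r ≤ m - ω.card := by
  obtain ⟨e⟩ := hH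
  let x : momentAngleComplex K := ⟨fun i ↦ if i ∈ ω then 0 else 1,
    mem_momentAngleComplex_iff.2 ⟨ω, hω, fun i ↦ by split_ifs <;> simp, fun i hi ↦ by simp [hi]⟩⟩
  have hfin : Finite (MulAction.stabilizer H x) := hf x
  -- The isotropy group of `x` consists of the elements of `H` that are trivial outside `ω`. A prime
  -- larger than its order excludes `p`-torsion in it.
  obtain ⟨p, hp, hprime⟩ := Nat.exists_infinite_primes (Nat.card (MulAction.stabilizer H x) + 1)
  have : NeZero p := ⟨hprime.ne_zero⟩
  have hone : ∀ g ∈ MulAction.stabilizer H x, g ^ p = 1 → g = 1 := by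
    intro g hg hgp
    rcases (Nat.dvd_prime hprime).1 (orderOf_dvd_of_pow_eq_one hgp) with h | h
    · exact orderOf_eq_one_iff.1 h
    · exfalso
      have h1 : orderOf (⟨g, hg⟩ : MulAction.stabilizer H x) ∣ _ := orderOf_dvd_natCard _
      rw [Subgroup.orderOf_mk, h] at h1
      have := Nat.le_of_dvd Nat.card_pos h1
      omega
  let A := {t : Circle // t ^ p = 1}
  have hA : Nat.card A = p := card_circle_torsion p
  have : Finite A := Nat.finite_of_card_ne_zero (by rw [hA]; exact hprime.ne_zero)
  let u (a : Fin r → A) : H := e.symm fun i ↦ (a i).1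
  have hu : ∀ a, u a ^ p = 1 := fun a ↦ by
    rw [← map_pow, show (fun i ↦ (a i).1) ^ p = 1 from funext fun i ↦ (a i).2, map_one]
  -- The `p ^ r` elements of `p`-torsion in `H` are compared with the `p ^ (m - |ω|)` possible
  -- families of coordinates outside `ω`. Two with equal coordinates there differ by `p`-torsion in
  -- the stabilizer, hence coincide.
  let Φ (a : Fin r → A) (j : {j // j ∉ ω}) : A :=
    ⟨(u a).1 j, congrFun (congrArg Subtype.val (hu a)) j⟩
  have hΦ : Function.Injective Φ := by
    intro a b hab
    have hg : u a / u b ∈ MulAction.stabilizer H x := by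
      refine Subtype.ext (funext fun i ↦ ?_)
      change ((((u a).1 / (u b).1) i : Circle) : ℂ) * (if i ∈ ω then 0 else 1) =
        if i ∈ ω then 0 else 1
      by_cases hi : i ∈ ω
      · simp [hi]
      · have : (u a).1 i = (u b).1 i := congrArg Subtype.val (congrFun hab ⟨i, hi⟩)
        simp [hi, this]
    have h1 := hone _ hg (by rw [div_pow, hu, hu, div_one])
    have h2 := e.symm.injective (div_eq_one.1 h1)
    exact funext fun i ↦ Subtype.ext (congrFun h2 i)
  have hle := Nat.card_le_card_of_injective Φ hΦ
  rw [Nat.card_fun, Nat.card_fun, hA, Nat.card_eq_fintype_card, Nat.card_eq_fintype_card,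
    Fintype.card_fin, Fintype.card_subtype_compl, Fintype.card_fin, Fintype.card_coe] at hle
  exact (Nat.pow_le_pow_iff_right hprime.one_lt).1 hle

theorem two_pow_le_hrk {ω : Finset (Fin m)} (hω : Maximal (IsSimplex K) ω) :
    (2 : ℕ∞) ^ (m - ω.card) ≤ hrk (momentAngleComplex K) := by
  have := natCast_le_hrk ((two_pow_le_subRank hω).trans (subRank_le_subRank_univ _))
  exact_mod_cast this

theorem mdim_le_dim : mdim K ≤ dim K := by
  classical
  obtain ⟨ω, hω, h⟩ := exists_maximal_card_eq_mdim K
  rw [← h, dim]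
  exact sub_le_sub_right (Nat.cast_le.2 (Finset.le_sup (f := Finset.card)
    (Finset.mem_filter.2 ⟨Finset.mem_univ _, hω.1⟩))) 1

end Subtori

end MomentAngle

end

theorem mainTheorem2 (m : ℕ) (K : PreAbstractSimplicialComplex (Fin m)) :
    (2 : ℝ≥0∞) ^ ((m : ℤ) - MomentAngle.mdim K - 1)
        ≤ (MomentAngle.hrk (MomentAngle.momentAngleComplex K) : ℝ≥0∞) ∧
      (2 : ℝ≥0∞) ^ ((m : ℤ) - MomentAngle.dim K - 1)
        ≤ (2 : ℝ≥0∞) ^ ((m : ℤ) - MomentAngle.mdim K - 1) ∧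
      ∀ (r : ℕ) (H : Subgroup (Fin m → Circle)), MomentAngle.IsSubtorus H r →
        MomentAngle.IsAlmostFree H (MomentAngle.momentAngleComplex K) →
        (2 : ℕ∞) ^ r ≤ MomentAngle.hrk (MomentAngle.momentAngleComplex K) := by
  obtain ⟨ω, hω, h⟩ := MomentAngle.exists_maximal_card_eq_mdim K
  have hrk_ge := MomentAngle.two_pow_le_hrk hω
  refine ⟨?_, ENNReal.zpow_le_of_le one_le_two ?_, fun r H hH hf ↦ ?_⟩
  · have hc : ω.card ≤ m := by simpa using Finset.card_le_univ ω
    have he : (m : ℤ) - MomentAngle.mdim K - 1 = ((m - ω.card : ℕ) : ℤ) := by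
      rw [← h, Nat.cast_sub hc]
      ring
    rw [he, zpow_natCast]
    have := ENat.toENNReal_le.2 hrk_ge
    simpa using this
  · have := MomentAngle.mdim_le_dim (K := K)
    linarith
  -- The same maximal simplex `ω` bounds the rank of the torus from above and `hrk` from below.
  · exact (pow_le_pow_right₀ one_le_two
      (MomentAngle.rank_le_of_isAlmostFree hω.1 hH hf)).trans hrk_ge
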